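/- **Theorem 1.1 (Barthe and Cordero-Erausquin).** Let $n \ge 0$ and let $d\gamma(w) = \pi^{-n} e^{-|w|^2}\, d\ell(w)$ be the standard complex Gaussian measure on $\mathbb{C}^n$, where $\ell$ is Lebesgue measure on $\mathbb{C}^n \simeq \mathbb{R}^{2n}$. Let $f, g : \mathbb{C}^n \to [-\infty, \infty)$ be plurisubharmonic functions, i.e. upper semicontinuous functions with $$h(z) \le \frac{1}{2\pi} \int_{-\pi}^{\pi} h(z + e^{i\theta} w)\, d\theta \qquad \text{for all } z, w \in \mathbb{C}^n$$ for $h = f$ and $h = g$. Assume that $f$ and $g$ have controlled growth at infinity in the sense that $\int |f|^2\, d\gamma < \infty$ and $\int |g|^2\, d\gamma < \infty$. If $f$ is circular-symmetric, that is, $f(e^{i\theta} w) = f(w)$ for all $\theta \in [-\pi, \pi]$ and all $w \in \mathbb{C}^n$, then $f$, $g$ and $fg$ are $\gamma$-integrable and $$\int f g \, d\gamma \;\ge\; \int f \, d\gamma \int g \, d\gamma .$$ -/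

import Mathlib

noncomputable section

/-- The integral of a `[-∞, ∞]`-valued function: integral of the positive part minus integral of
the negative part. It is only used where the integral of the positive part is finite, so that
the difference is a well-defined element of `[-∞, ∞)`. -/
def extIntegral {X : Type*} [MeasurableSpace X] (μ : MeasureTheory.Measure X) (f : X → EReal) :
    EReal :=
  ((∫⁻ x, (f x).toENNReal ∂μ : ENNReal) : EReal) - ((∫⁻ x, (-f x).toENNReal ∂μ : ENNReal) : EReal)

/-- The uniform probability measure `dθ / (2π)` on the interval `(-π, π]` of angles. -/
def angleMeasure : MeasureTheory.Measure ℝ :=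
  (ENNReal.ofReal (2 * Real.pi))⁻¹ • MeasureTheory.volume.restrict (Set.Ioc (-Real.pi) Real.pi)

/-- Plurisubharmonic functions `ℂⁿ → [-∞, ∞)`: upper semicontinuous functions, nowhere `+∞`, whose
restrictions to complex lines satisfy the sub-mean value inequality on all circles. The constant
`-∞` is allowed here. -/
structure IsPlurisubharmonic {n : ℕ} (f : EuclideanSpace ℂ (Fin n) → EReal) : Prop where
  lt_top : ∀ z, f z < ⊤
  upperSemicontinuous : UpperSemicontinuous f
  le_circle_average : ∀ z w : EuclideanSpace ℂ (Fin n),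
    f z ≤ extIntegral angleMeasure fun θ : ℝ => f (z + Complex.exp (θ * Complex.I) • w)

/-- `f (e^{iθ} w) = f w` for all angles `θ ∈ [-π, π]` and all `w`. -/
def IsCircularSymmetric {n : ℕ} (f : EuclideanSpace ℂ (Fin n) → EReal) : Prop :=
  ∀ θ ∈ Set.Icc (-Real.pi) Real.pi, ∀ w : EuclideanSpace ℂ (Fin n),
    f (Complex.exp ((θ : ℂ) * Complex.I) • w) = f w

/-- The standard complex Gaussian measure `π⁻ⁿ e^{-|w|²} dℓ(w)` on `ℂⁿ`. -/
def complexGaussian (n : ℕ) : MeasureTheory.Measure (EuclideanSpace ℂ (Fin n)) :=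
  (MeasureTheory.volume : MeasureTheory.Measure (EuclideanSpace ℂ (Fin n))).withDensity
    fun w => ENNReal.ofReal ((Real.pi ^ n)⁻¹ * Real.exp (-‖w‖ ^ 2))

/-- The growth condition at infinity, in the form `f ∈ L²(γ)`: `∫ |f|² dγ < ∞`, where `|f| = ∞` at
points where `f = -∞`. -/
def IsGaussianSquareIntegrable {n : ℕ} (f : EuclideanSpace ℂ (Fin n) → EReal) : Prop :=
  ∫⁻ w, (f w).abs ^ 2 ∂(complexGaussian n) < ⊤

end

open MeasureTheory Complex Filter Topology
open scoped ComplexConjugate ComplexOrder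

/-! ### Gaussian laws on ℂⁿ × ℂⁿ through characteristic functions -/

section gauss
variable {n : ℕ}

/-! Interpolate by correlation. For `s` in the closed unit disc let `(Z, W)` be standard complex
Gaussian vectors with `E W Z* = s`, and put `Φ(s) = E f(Z) g(W)` (`gaussianCorr`). Then `Φ(0) = ∫ f
∫ g` and `Φ(1) = ∫ f g`. Rotating `Z` rotates `s`, so circular symmetry of `f` makes `Φ` radial. If
`Φ` is continuous and subharmonic, the maximum principle gives `Φ(0) ≤ Φ(1)`.

Subharmonicity is needed only infinitesimally and, by radiality, only at real points `0 ≤ r < 1`.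
There write `Z = √r U + √(1-r) V` and `W = √r U + √(1-r) V'`, where `U` is independent of a pair
`(V, V')` of correlation `τ`; the total correlation is `r + (1-r)τ`
(`map_mixVec_prod_gaussianPair`). With `U` frozen, both functions are still plurisubharmonic in the
remaining variable, so only `τ` near `0` matters. The law of `(V, V')` has the Mehler kernel as
density, and averaging it over `τ = ±t, ±it` gives `1 + t² q(v, w) + O(t³)` with `q(v, w) = |⟪v,
w⟫|² - |v|² - |w|² + n` (`exists_abs_mehlerKernel_four_avg_le`).

It remains to see that `∬ f(v) g(w) q(v, w) ≥ 0`. This double integral is `tr(A_f A_g)`, where `A_f`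
is the Hermitian matrix with quadratic form `u ↦ ∫ f(w) (|⟪u, w⟫|² - |u|²) dγ`. Plurisubharmonicity
makes both matrices positive semidefinite: average `f` over the circle `w + e^{iθ} εu`, move the
translation onto the Gaussian density, and read off the `ε²` term
(`integral_mul_norm_inner_sq_sub_nonneg`). No derivative of `f` or `g` is ever taken; all
derivatives fall on Gaussian densities. -/

lemma real_inner_eq_re (a x : EuclideanSpace ℂ (Fin n)) : inner ℝ a x = (inner ℂ a x).re := by
  simp only [PiLp.inner_apply, Complex.re_sum]
  rfl

lemma finrank_real_euclideanSpace_complex :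
    Module.finrank ℝ (EuclideanSpace ℂ (Fin n)) = 2 * n := by
  rw [← Module.finrank_mul_finrank ℝ ℂ]
  simp

lemma integral_complexGaussian {F : Type*} [NormedAddCommGroup F] [NormedSpace ℝ F]
    (φ : EuclideanSpace ℂ (Fin n) → F) :
    ∫ w, φ w ∂(complexGaussian n) = ∫ w, ((Real.pi ^ n)⁻¹ * Real.exp (-‖w‖ ^ 2)) • φ w := by
  rw [complexGaussian, integral_withDensity_eq_integral_toReal_smul (by fun_prop) (by simp)]
  refine integral_congr_ae (ae_of_all _ fun w => ?_)
  simp only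
  rw [ENNReal.toReal_ofReal (by positivity)]

lemma integral_cexp_inner_complexGaussian (a : EuclideanSpace ℂ (Fin n)) :
    ∫ w, cexp ((inner ℂ a w).re * I) ∂(complexGaussian n) = cexp (-(‖a‖ : ℂ) ^ 2 / 4) := by
  rw [integral_complexGaussian]
  have h := GaussianFourier.integral_cexp_neg_mul_sq_norm_add (b := 1) (by simp) I a
  rw [finrank_real_euclideanSpace_complex] at h
  have h2 : ((Real.pi : ℂ) / 1) ^ (((2 * n : ℕ) : ℂ) / 2) = (Real.pi : ℂ) ^ n := by
    push_cast
    rw [mul_div_cancel_left₀ _ (two_ne_zero), Complex.cpow_natCast, div_one]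
  rw [h2] at h
  have h3 : ∀ w : EuclideanSpace ℂ (Fin n), ((Real.pi ^ n)⁻¹ * Real.exp (-‖w‖ ^ 2)) •
      cexp ((inner ℂ a w).re * I) = ((Real.pi : ℂ) ^ n)⁻¹ *
        cexp (-1 * (‖w‖ : ℂ) ^ 2 + I * (inner ℝ a w : ℝ)) := by
    intro w
    rw [real_inner_eq_re, Complex.exp_add, Complex.real_smul]
    push_cast
    rw [neg_one_mul, mul_comm I]
    ring
  simp_rw [h3]
  rw [integral_const_mul, h, ← mul_assoc, inv_mul_cancel₀, one_mul]
  · congr 1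
    rw [I_sq]; ring
  · exact pow_ne_zero _ (by exact_mod_cast Real.pi_ne_zero)

instance isProbabilityMeasure_complexGaussian : IsProbabilityMeasure (complexGaussian n) := by
  have h := integral_cexp_inner_complexGaussian (n := n) 0
  simp only [inner_zero_left, zero_re, ofReal_zero, zero_mul, Complex.exp_zero, integral_const,
    norm_zero] at h
  have h' : (complexGaussian n).real Set.univ = 1 := by
    have := congrArg Complex.re h
    simpa using this
  constructor
  rw [measureReal_def] at h'
  exact (ENNReal.toReal_eq_one_iff _).1 h'

/-- A real-linear functional on the product splits into two, and Riesz represents each as the real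
part of a complex inner product, so these exponentials are all the characters. -/
lemma measure_prod_ext_of_integral_cexp {μ ν : Measure (EuclideanSpace ℂ (Fin n) × EuclideanSpace ℂ (Fin n))}
    [IsFiniteMeasure μ] [IsFiniteMeasure ν]
    (h : ∀ a b : EuclideanSpace ℂ (Fin n),
      ∫ p, cexp (((inner ℂ a p.1).re + (inner ℂ b p.2).re : ℝ) * I) ∂μ =
      ∫ p, cexp (((inner ℂ a p.1).re + (inner ℂ b p.2).re : ℝ) * I) ∂ν) : μ = ν := by
  apply Measure.ext_of_charFunDual
  ext L
  simp only [charFunDual_apply]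
  obtain ⟨a, ha⟩ := (InnerProductSpace.toDual ℝ (EuclideanSpace ℂ (Fin n))).surjective
    (L ∘SL ContinuousLinearMap.inl ℝ _ _)
  obtain ⟨b, hb⟩ := (InnerProductSpace.toDual ℝ (EuclideanSpace ℂ (Fin n))).surjective
    (L ∘SL ContinuousLinearMap.inr ℝ _ _)
  have hL : ∀ p, L p = (inner ℂ a p.1).re + (inner ℂ b p.2).re := by
    intro p
    rw [← real_inner_eq_re, ← real_inner_eq_re, ← InnerProductSpace.toDual_apply_apply,
      ← InnerProductSpace.toDual_apply_apply, ha, hb]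
    simp [← map_add]
  simp_rw [hL]
  exact h a b

lemma integral_cexp_inner_triple (a b c : EuclideanSpace ℂ (Fin n)) :
    ∫ p, cexp (((inner ℂ a p.1).re + (inner ℂ b p.2.1).re + (inner ℂ c p.2.2).re : ℝ) * I)
      ∂((complexGaussian n).prod ((complexGaussian n).prod (complexGaussian n))) =
    cexp (-((‖a‖ ^ 2 + ‖b‖ ^ 2 + ‖c‖ ^ 2 : ℝ) : ℂ) / 4) := by
  have : ∀ p : EuclideanSpace ℂ (Fin n) × EuclideanSpace ℂ (Fin n) × EuclideanSpace ℂ (Fin n),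
      cexp (((inner ℂ a p.1).re + (inner ℂ b p.2.1).re + (inner ℂ c p.2.2).re : ℝ) * I) =
      cexp ((inner ℂ a p.1).re * I) * (cexp ((inner ℂ b p.2.1).re * I) *
        cexp ((inner ℂ c p.2.2).re * I)) := by
    intro p
    rw [← Complex.exp_add, ← Complex.exp_add]
    congr 1
    push_cast
    ring
  simp_rw [this]
  rw [integral_prod_mul (fun x => cexp ((inner ℂ a x).re * I))
    (fun x : EuclideanSpace ℂ (Fin n) × EuclideanSpace ℂ (Fin n) => cexp ((inner ℂ b x.1).re * I) *
        cexp ((inner ℂ c x.2).re * I)),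
    integral_prod_mul (fun x => cexp ((inner ℂ b x).re * I))
    (fun x => cexp ((inner ℂ c x).re * I))]
  simp_rw [integral_cexp_inner_complexGaussian, ← Complex.exp_add]
  congr 1
  push_cast
  ring

lemma norm_add_smul_sq (x y : ℂ) (a b : EuclideanSpace ℂ (Fin n)) :
    ‖x • a + y • b‖ ^ 2 = ‖x‖ ^ 2 * ‖a‖ ^ 2 + ‖y‖ ^ 2 * ‖b‖ ^ 2 +
      2 * (conj x * y * inner ℂ a b).re := by
  rw [@norm_add_sq ℂ, norm_smul, norm_smul, inner_smul_left, inner_smul_right]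
  simp only [RCLike.re_to_complex, mul_pow]
  rw [mul_assoc]; ring

/-- The joint law of `(Z, W)`, two standard complex Gaussian vectors with `E W Z* = s`. -/
noncomputable def gaussianPair (n : ℕ) (s : ℂ) : Measure (EuclideanSpace ℂ (Fin n) × EuclideanSpace ℂ (Fin n)) :=
  ((complexGaussian n).prod (complexGaussian n)).map
    fun p => (p.1, s • p.1 + (Real.sqrt (1 - ‖s‖ ^ 2) : ℂ) • p.2)

lemma measurable_gaussianPair_map (s t : ℂ) : Measurable
    fun p : EuclideanSpace ℂ (Fin n) × EuclideanSpace ℂ (Fin n) => (p.1, s • p.1 + t • p.2) := by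
  fun_prop

instance isProbabilityMeasure_gaussianPair (s : ℂ) : IsProbabilityMeasure (gaussianPair n s) :=
  Measure.isProbabilityMeasure_map (measurable_gaussianPair_map _ _).aemeasurable

lemma integral_cexp_map_triple (α₁ α₂ α₃ β₁ β₂ β₃ : ℂ) (a b : EuclideanSpace ℂ (Fin n))
    (hα : ‖α₁‖ ^ 2 + ‖α₂‖ ^ 2 + ‖α₃‖ ^ 2 = 1) (hβ : ‖β₁‖ ^ 2 + ‖β₂‖ ^ 2 + ‖β₃‖ ^ 2 = 1) :
    ∫ p, cexp (((inner ℂ a p.1).re + (inner ℂ b p.2).re : ℝ) * I)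
      ∂(((complexGaussian n).prod ((complexGaussian n).prod (complexGaussian n))).map
        fun p => (α₁ • p.1 + (α₂ • p.2.1 + α₃ • p.2.2), β₁ • p.1 + (β₂ • p.2.1 + β₃ • p.2.2))) =
    cexp (-((‖a‖ ^ 2 + ‖b‖ ^ 2 +
      2 * ((α₁ * conj β₁ + α₂ * conj β₂ + α₃ * conj β₃) * inner ℂ a b).re : ℝ) : ℂ) / 4) := by
  rw [integral_map (by fun_prop) (by fun_prop)]
  have h := integral_cexp_inner_triple (conj α₁ • a + conj β₁ • b) (conj α₂ • a + conj β₂ • b)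
    (conj α₃ • a + conj β₃ • b)
  convert h using 1
  · refine integral_congr_ae (ae_of_all _ fun p => ?_)
    simp only [inner_add_right, inner_add_left, inner_smul_left, inner_smul_right,
      RingHomCompTriple.comp_apply, RingHom.id_apply, Complex.add_re]
    congr 2
    push_cast
    ring
  · simp only [norm_add_smul_sq, RCLike.norm_conj, Complex.conj_conj, add_mul, Complex.add_re]
    congr 3
    norm_cast
    linear_combination (-‖a‖ ^ 2) * hα - ‖b‖ ^ 2 * hβ

/-- Complex-linear images of circular Gaussians are determined by their Hermitian covariance. Each
later identity between laws thus reduces to a check on the coefficients. -/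
lemma map_triple_eq_gaussianPair {α₁ α₂ α₃ β₁ β₂ β₃ s : ℂ}
    (hα : ‖α₁‖ ^ 2 + ‖α₂‖ ^ 2 + ‖α₃‖ ^ 2 = 1) (hβ : ‖β₁‖ ^ 2 + ‖β₂‖ ^ 2 + ‖β₃‖ ^ 2 = 1)
    (hs : β₁ * conj α₁ + β₂ * conj α₂ + β₃ * conj α₃ = s) (hs1 : ‖s‖ ≤ 1) :
    ((complexGaussian n).prod ((complexGaussian n).prod (complexGaussian n))).map
        (fun p => (α₁ • p.1 + (α₂ • p.2.1 + α₃ • p.2.2), β₁ • p.1 + (β₂ • p.2.1 + β₃ • p.2.2))) =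
      gaussianPair n s := by
  have hm : ∀ x₁ x₂ x₃ y₁ y₂ y₃ : ℂ, Measurable (fun p : EuclideanSpace ℂ (Fin n) ×
      EuclideanSpace ℂ (Fin n) × EuclideanSpace ℂ (Fin n) =>
        (x₁ • p.1 + (x₂ • p.2.1 + x₃ • p.2.2), y₁ • p.1 + (y₂ • p.2.1 + y₃ • p.2.2))) := by
    intros; fun_prop
  set ρ : ℂ := (Real.sqrt (1 - ‖s‖ ^ 2) : ℂ) with hρ
  have hρ2 : ‖ρ‖ ^ 2 = 1 - ‖s‖ ^ 2 := by
    have : 0 ≤ 1 - ‖s‖ ^ 2 := by nlinarith [norm_nonneg s]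
    rw [hρ, Complex.norm_real, Real.norm_eq_abs, sq_abs, Real.sq_sqrt this]
  -- The first of the three Gaussians is a dummy, so that both laws become images of the same
  -- triple.
  have h2 : gaussianPair n s =
      ((complexGaussian n).prod ((complexGaussian n).prod (complexGaussian n))).map
        (fun p => ((0 : ℂ) • p.1 + ((1 : ℂ) • p.2.1 + (0 : ℂ) • p.2.2),
          (0 : ℂ) • p.1 + (s • p.2.1 + ρ • p.2.2))) := by
    have h3 : ((complexGaussian n).prod ((complexGaussian n).prod (complexGaussian n))).map Prod.snd
        = (complexGaussian n).prod (complexGaussian n) := by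
      rw [Measure.map_snd_prod]; simp
    rw [gaussianPair]
    conv_lhs => rw [← h3]
    rw [Measure.map_map (measurable_gaussianPair_map _ _) measurable_snd]
    congr 1
    ext p <;> simp [hρ]
  have : IsProbabilityMeasure (((complexGaussian n).prod ((complexGaussian n).prod
      (complexGaussian n))).map (fun p => (α₁ • p.1 + (α₂ • p.2.1 + α₃ • p.2.2),
        β₁ • p.1 + (β₂ • p.2.1 + β₃ • p.2.2)))) :=
    Measure.isProbabilityMeasure_map (hm _ _ _ _ _ _).aemeasurable
  refine measure_prod_ext_of_integral_cexp fun a b => ?_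
  rw [integral_cexp_map_triple _ _ _ _ _ _ a b hα hβ, h2, integral_cexp_map_triple]
  · rw [← hs]
    simp only [map_add, map_mul, Complex.conj_conj, map_zero, mul_zero, zero_mul, zero_add, add_zero,
      one_mul]
    congr 7
    ring
  · simp
  · rw [hρ2]; simp
end gauss

/-! ### Marginals of the Gaussian pair and the Mehler density -/

section gauss
variable {n : ℕ}

lemma gaussianPair_zero : gaussianPair n 0 = (complexGaussian n).prod (complexGaussian n) := by
  have h : (fun p : EuclideanSpace ℂ (Fin n) × EuclideanSpace ℂ (Fin n) =>
      (p.1, (0 : ℂ) • p.1 + (Real.sqrt (1 - ‖(0 : ℂ)‖ ^ 2) : ℂ) • p.2)) = id := by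
    funext p
    simp
  rw [gaussianPair, h, Measure.map_id]

lemma map_fst_gaussianPair (s : ℂ) : (gaussianPair n s).map Prod.fst = complexGaussian n := by
  rw [gaussianPair, Measure.map_map measurable_fst (measurable_gaussianPair_map _ _)]
  have : (Prod.fst ∘ fun p : EuclideanSpace ℂ (Fin n) × EuclideanSpace ℂ (Fin n) =>
    (p.1, s • p.1 + (Real.sqrt (1 - ‖s‖ ^ 2) : ℂ) • p.2)) = Prod.fst := rfl
  rw [this, Measure.map_fst_prod]
  simp

lemma norm_ofReal_sqrt_sq {x : ℝ} (hx : 0 ≤ x) : ‖(Real.sqrt x : ℂ)‖ ^ 2 = x := by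
  rw [Complex.norm_real, Real.norm_eq_abs, sq_abs, Real.sq_sqrt hx]

lemma map_snd_gaussianPair {s : ℂ} (hs : ‖s‖ ≤ 1) :
    (gaussianPair n s).map Prod.snd = complexGaussian n := by
  have h0 : 0 ≤ 1 - ‖s‖ ^ 2 := by nlinarith [norm_nonneg s]
  set ρ : ℂ := (Real.sqrt (1 - ‖s‖ ^ 2) : ℂ) with hρ
  have hρ2 : ‖ρ‖ ^ 2 = 1 - ‖s‖ ^ 2 := norm_ofReal_sqrt_sq h0
  -- The vector `sZ + ρW` is placed first in an independent pair, so that the known first marginal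
  -- applies to it.
  have h1 := map_triple_eq_gaussianPair (n := n) (α₁ := s) (α₂ := ρ) (α₃ := 0) (β₁ := 0) (β₂ := 0)
    (β₃ := 1) (s := 0) (by rw [hρ2]; simp) (by simp) (by simp) (by simp)
  have h2 := map_triple_eq_gaussianPair (n := n) (α₁ := 1) (α₂ := 0) (α₃ := 0) (β₁ := s) (β₂ := ρ)
    (β₃ := 0) (s := s) (by simp) (by rw [hρ2]; simp) (by simp) hs
  have h3 := map_fst_gaussianPair (n := n) 0
  rw [← h1, Measure.map_map measurable_fst (by fun_prop)] at h3
  rw [← h2, Measure.map_map measurable_snd (by fun_prop)]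
  refine Eq.trans (congrArg (fun F => Measure.map F _) ?_) h3
  funext p
  simp

lemma lintegral_complexGaussian {φ : EuclideanSpace ℂ (Fin n) → ENNReal} (hφ : Measurable φ) :
    ∫⁻ w, φ w ∂(complexGaussian n) =
      ∫⁻ w, ENNReal.ofReal ((Real.pi ^ n)⁻¹ * Real.exp (-‖w‖ ^ 2)) * φ w := by
  rw [complexGaussian, lintegral_withDensity_eq_lintegral_mul _ (by fun_prop) hφ]
  rfl

lemma lintegral_comp_add_smul (m : EuclideanSpace ℂ (Fin n)) {ρ : ℝ} (hρ : 0 < ρ)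
    {φ : EuclideanSpace ℂ (Fin n) → ENNReal} (hφ : Measurable φ) :
    ∫⁻ w, φ (m + ρ • w) = ENNReal.ofReal ((ρ ^ (2 * n))⁻¹) * ∫⁻ w, φ w := by
  have h := lintegral_map (μ := volume) (f := fun w => φ (m + w))
    (g := fun w : EuclideanSpace ℂ (Fin n) => ρ • w)
    (by fun_prop) (by fun_prop)
  rw [← h, Measure.map_addHaar_smul _ hρ.ne', lintegral_smul_measure,
    finrank_real_euclideanSpace_complex, lintegral_add_left_eq_self φ m, abs_of_pos (by positivity)]
  rfl

/-- Density of an affine image `m + ρ W` of a standard complex Gaussian `W` w.r.t. that Gaussian. -/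
lemma map_add_smul_complexGaussian (m : EuclideanSpace ℂ (Fin n)) {ρ : ℝ} (hρ : 0 < ρ) :
    (complexGaussian n).map (fun w => m + ρ • w) = (complexGaussian n).withDensity
      fun y => ENNReal.ofReal ((ρ ^ (2 * n))⁻¹ * Real.exp (‖y‖ ^ 2 - ‖y - m‖ ^ 2 / ρ ^ 2)) := by
  refine Measure.ext_of_lintegral _ fun φ hφ => ?_
  rw [lintegral_map hφ (by fun_prop), lintegral_withDensity_eq_lintegral_mul _ (by fun_prop) hφ,
    lintegral_complexGaussian (by fun_prop), lintegral_complexGaussian (by fun_prop)]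
  have h := lintegral_comp_add_smul m hρ (φ := fun y => ENNReal.ofReal ((Real.pi ^ n)⁻¹ *
    Real.exp (-‖ρ⁻¹ • (y - m)‖ ^ 2)) * φ y) (by fun_prop)
  simp only [add_sub_cancel_left, smul_smul, inv_mul_cancel₀ hρ.ne', one_smul] at h
  rw [h, ← lintegral_const_mul _ (by fun_prop)]
  refine lintegral_congr fun y => ?_
  simp only [Pi.mul_apply]
  rw [← mul_assoc, ← mul_assoc, ← ENNReal.ofReal_mul (by positivity),
    ← ENNReal.ofReal_mul (by positivity)]
  congr 2
  rw [norm_smul, norm_inv, Real.norm_eq_abs, mul_pow, inv_pow, sq_abs]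
  calc _ = (Real.pi ^ n)⁻¹ * ((ρ ^ (2 * n))⁻¹ * Real.exp (-((ρ ^ 2)⁻¹ * ‖y - m‖ ^ 2))) := by ring
    _ = (Real.pi ^ n)⁻¹ * ((ρ ^ (2 * n))⁻¹ *
        (Real.exp (-‖y‖ ^ 2) * Real.exp (‖y‖ ^ 2 - ‖y - m‖ ^ 2 / ρ ^ 2))) := by
      rw [← Real.exp_add]
      congr 3
      ring
    _ = _ := by ring

/-- The density of `gaussianPair n τ` w.r.t. the product Gaussian. -/
noncomputable def mehlerKernel (n : ℕ) (τ : ℂ) (p : EuclideanSpace ℂ (Fin n) × EuclideanSpace ℂ (Fin n)) : ℝ :=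
  ((1 - ‖τ‖ ^ 2) ^ n)⁻¹ * Real.exp ((2 * (conj τ * inner ℂ p.1 p.2).re
    - ‖τ‖ ^ 2 * (‖p.1‖ ^ 2 + ‖p.2‖ ^ 2)) / (1 - ‖τ‖ ^ 2))

lemma continuous_mehlerKernel (τ : ℂ) : Continuous (mehlerKernel n τ) := by
  unfold mehlerKernel
  fun_prop

lemma mehlerKernel_nonneg {τ : ℂ} (hτ : ‖τ‖ < 1)
    (p : EuclideanSpace ℂ (Fin n) × EuclideanSpace ℂ (Fin n)) : 0 ≤ mehlerKernel n τ p := by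
  have : 0 < 1 - ‖τ‖ ^ 2 := by nlinarith [norm_nonneg τ]
  unfold mehlerKernel
  positivity

/-- Given `Z = v`, the second vector is the affine image `τv + ρW` of a Gaussian, whose density is
known; Tonelli assembles the fibres. -/
lemma gaussianPair_eq_withDensity {τ : ℂ} (hτ : ‖τ‖ < 1) :
    gaussianPair n τ = ((complexGaussian n).prod (complexGaussian n)).withDensity
      fun p => ENNReal.ofReal (mehlerKernel n τ p) := by
  have h0 : 0 < 1 - ‖τ‖ ^ 2 := by nlinarith [norm_nonneg τ]
  set ρ := Real.sqrt (1 - ‖τ‖ ^ 2) with hρ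
  have hρ0 : 0 < ρ := Real.sqrt_pos.2 h0
  have hρ2 : ρ ^ 2 = 1 - ‖τ‖ ^ 2 := Real.sq_sqrt h0.le
  have hK : Measurable fun p => ENNReal.ofReal (mehlerKernel n τ p) :=
    (continuous_mehlerKernel τ).measurable.ennreal_ofReal
  refine Measure.ext_of_lintegral _ fun φ hφ => ?_
  rw [gaussianPair, lintegral_map hφ (measurable_gaussianPair_map _ _),
    lintegral_withDensity_eq_lintegral_mul _ hK hφ,
    lintegral_prod _ (by fun_prop),
    lintegral_prod _ (hK.mul hφ).aemeasurable]
  refine lintegral_congr fun v => ?_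
  have h := congrArg (fun μ => ∫⁻ y, φ (v, y) ∂μ) (map_add_smul_complexGaussian (τ • v) hρ0)
  rw [lintegral_map (by fun_prop) (by fun_prop),
    lintegral_withDensity_eq_lintegral_mul _ (by fun_prop) (by fun_prop)] at h
  simp only [← hρ, Complex.coe_smul]
  rw [h]
  refine lintegral_congr fun y => ?_
  simp only [Pi.mul_apply]
  congr 2
  rw [mehlerKernel, pow_mul, hρ2]
  congr 2
  rw [@norm_sub_sq ℂ, norm_smul, inner_smul_right, ← inner_conj_symm y v, RCLike.re_to_complex,
    ← Complex.conj_re (τ * _), map_mul, Complex.conj_conj]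
  field_simp
  ring
end gauss

/-! ### Second-order expansions with explicit remainders -/

section estimates

lemma abs_exp_sub_quadratic_le {y P : ℝ} (hy : |y| ≤ P) :
    |Real.exp y - 1 - y - y ^ 2 / 2| ≤ P ^ 3 * Real.exp P := by
  have h := Complex.norm_exp_sub_sum_le_norm_mul_exp (y : ℂ) 3
  have h2 : Complex.exp y - ∑ m ∈ Finset.range 3, (y : ℂ) ^ m / m.factorial =
      ((Real.exp y - 1 - y - y ^ 2 / 2 : ℝ) : ℂ) := by
    simp [Finset.sum_range_succ, Nat.factorial]
    ring
  rw [h2, Complex.norm_real, Complex.norm_real, Real.norm_eq_abs, Real.norm_eq_abs] at h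
  exact h.trans (mul_le_mul (pow_le_pow_left₀ (abs_nonneg y) hy 3) (Real.exp_le_exp.2 hy)
    (Real.exp_nonneg _) (pow_nonneg ((abs_nonneg y).trans hy) 3))

/-- The signs `±p`, `±q` cancel the linear and cross terms of the Taylor polynomials. -/
lemma abs_exp_four_avg_sub_le {a p q P : ℝ} (hp : |a| + |p| ≤ P) (hq : |a| + |q| ≤ P) :
    |(Real.exp (a + p) + Real.exp (a - p) + Real.exp (a + q) + Real.exp (a - q)) / 4
      - (1 + a + a ^ 2 / 2 + (p ^ 2 + q ^ 2) / 4)| ≤ P ^ 3 * Real.exp P := by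
  have h1 := abs_exp_sub_quadratic_le ((abs_add_le a p).trans hp)
  have h2 := abs_exp_sub_quadratic_le ((abs_sub a p).trans hp)
  have h3 := abs_exp_sub_quadratic_le ((abs_add_le a q).trans hq)
  have h4 := abs_exp_sub_quadratic_le ((abs_sub a q).trans hq)
  rw [abs_le] at *
  constructor <;> linarith

lemma exists_one_add_pow_le_exp (k : ℕ) {c : ℝ} (hc : 0 < c) :
    ∃ C : ℝ, 0 ≤ C ∧ ∀ N : ℝ, 0 ≤ N → (1 + N) ^ k ≤ C * Real.exp (c * N) := by
  refine ⟨k.factorial * (c⁻¹) ^ k * Real.exp c, by positivity, fun N hN => ?_⟩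
  have h := Real.pow_div_factorial_le_exp (c * (1 + N)) (by positivity) k
  rw [div_le_iff₀ (by positivity)] at h
  rw [mul_add, mul_one, Real.exp_add, ← mul_one_add, mul_pow] at h
  calc (1 + N) ^ k = (c⁻¹) ^ k * (c ^ k * (1 + N) ^ k) := by
        rw [← mul_assoc, ← mul_pow, inv_mul_cancel₀ hc.ne', one_pow, one_mul]
    _ ≤ (c⁻¹) ^ k * (Real.exp c * Real.exp (c * N) * k.factorial) := by gcongr
    _ = _ := by ring

lemma exists_abs_inv_one_sub_pow_sub_le (n : ℕ) : ∃ C : ℝ, 0 ≤ C ∧ ∀ x : ℝ, 0 ≤ x → x ≤ 1 / 2 →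
    |((1 - x) ^ n)⁻¹ - (1 + n * x)| ≤ C * x ^ 2 := by
  induction n with
  | zero => exact ⟨0, le_rfl, fun x _ _ => by simp⟩
  | succ n ih =>
    obtain ⟨C, hC, h⟩ := ih
    refine ⟨2 * C + 2 * (n + 1), by positivity, fun x hx hx' => ?_⟩
    have hD : 0 < 1 - x := by linarith
    have hD2 : (1 - x)⁻¹ ≤ 2 := by
      rw [inv_le_comm₀ hD (by norm_num)]; linarith
    have e : ((1 - x) ^ (n + 1))⁻¹ - (1 + ((n + 1 : ℕ) : ℝ) * x) =
        (1 - x)⁻¹ * ((((1 - x) ^ n)⁻¹ - (1 + n * x)) + (n + 1) * x ^ 2) := by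
      rw [pow_succ]
      push_cast
      field_simp
      ring
    rw [e, abs_mul, abs_of_pos (inv_pos.2 hD)]
    calc (1 - x)⁻¹ * |(((1 - x) ^ n)⁻¹ - (1 + n * x)) + (n + 1) * x ^ 2|
        ≤ 2 * (C * x ^ 2 + (n + 1) * x ^ 2) := by
          gcongr
          refine (abs_add_le _ _).trans (add_le_add (h x hx hx') (abs_of_nonneg (by positivity)).le)
      _ = _ := by ring

/-- Second-order expansion of the four-point average of exponentials in Cameron-Martin densities. -/
lemma exists_abs_exp_four_avg_translate_le (U : ℝ) (hU : 0 ≤ U) : ∃ C : ℝ, 0 ≤ C ∧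
    ∀ ε M x y : ℝ, 0 < ε → ε ≤ 1 → 0 ≤ M → x ^ 2 + y ^ 2 ≤ U * M →
    |(Real.exp (-(ε ^ 2 * U) + 2 * ε * x) + Real.exp (-(ε ^ 2 * U) - 2 * ε * x)
      + Real.exp (-(ε ^ 2 * U) + 2 * ε * y) + Real.exp (-(ε ^ 2 * U) - 2 * ε * y)) / 4
      - (1 + ε ^ 2 * (x ^ 2 + y ^ 2 - U))| ≤ C * ε ^ 3 * Real.exp (M / 4) := by
  refine ⟨6 * Real.exp (34 * U) + U ^ 2 / 2, by positivity, fun ε M x y hε hε1 hM hxy => ?_⟩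
  -- One `U` absorbs the constant term of the exponent; `16U + M/16` dominates `2√(UM)`. Since `2P ≤
  -- 34U + M/4`, two factors `exp P` still fit under the target weight.
  set P : ℝ := 17 * U + M / 16 with hP
  have hP0 : 0 ≤ P := by positivity
  have key : ∀ z : ℝ, z ^ 2 ≤ U * M → |-(ε ^ 2 * U)| + |2 * ε * z| ≤ ε * P := by
    intro z hz
    rw [abs_neg, abs_of_nonneg (by positivity : 0 ≤ ε ^ 2 * U), abs_mul,
      abs_of_pos (by positivity : 0 < 2 * ε)]
    have h1 : 2 * |z| ≤ 16 * U + M / 16 := by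
      refine abs_le_of_sq_le_sq' ?_ (by positivity) |>.2
      rw [mul_pow, sq_abs]
      nlinarith [sq_nonneg (16 * U - M / 16)]
    have h2 : ε ^ 2 * U ≤ ε * U := by
      have : ε ^ 2 ≤ ε := by nlinarith
      gcongr
    calc _ ≤ ε * U + ε * (2 * |z|) := by linarith
      _ ≤ ε * U + ε * (16 * U + M / 16) := by gcongr
      _ = _ := by rw [hP]; ring
  have h := abs_exp_four_avg_sub_le (key x (by nlinarith)) (key y (by nlinarith))
  have e1 : (ε * P) ^ 3 * Real.exp (ε * P) ≤ 6 * Real.exp (34 * U) * ε ^ 3 * Real.exp (M / 4) := by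
    have h1 : P ^ 3 ≤ 6 * Real.exp P := by
      have := Real.pow_div_factorial_le_exp P hP0 3
      rw [div_le_iff₀ (by positivity)] at this
      simpa [Nat.factorial, mul_comm] using this
    have h2 : Real.exp (ε * P) ≤ Real.exp P := Real.exp_le_exp.2 (by nlinarith)
    calc (ε * P) ^ 3 * Real.exp (ε * P) ≤ ε ^ 3 * (6 * Real.exp P) * Real.exp P := by
          rw [mul_pow]; gcongr
      _ = 6 * ε ^ 3 * Real.exp (P + P) := by rw [Real.exp_add P P]; ring
      _ ≤ 6 * ε ^ 3 * Real.exp (34 * U + M / 4) := by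
          have : P + P ≤ 34 * U + M / 4 := by rw [hP]; linarith
          gcongr
      _ = _ := by rw [Real.exp_add]; ring
  have e2 : ε ^ 4 * U ^ 2 / 2 ≤ U ^ 2 / 2 * ε ^ 3 * Real.exp (M / 4) := by
    have : (1 : ℝ) ≤ Real.exp (M / 4) := Real.one_le_exp (by positivity)
    have h4 : ε ^ 4 ≤ ε ^ 3 := pow_le_pow_of_le_one hε.le hε1 (by norm_num)
    calc ε ^ 4 * U ^ 2 / 2 ≤ ε ^ 3 * U ^ 2 / 2 := by gcongr
      _ = U ^ 2 / 2 * ε ^ 3 * 1 := by ring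
      _ ≤ _ := by gcongr
  have e3 : 0 ≤ ε ^ 4 * U ^ 2 / 2 := by positivity
  rw [abs_le] at *
  constructor <;> nlinarith

/-- Here `D` stands for `1/(1 - t²)`; this is the cost of replacing it by `1` in the quadratic
Taylor polynomial and of dropping the `t⁴` term. -/
lemma abs_mehler_quadratic_sub_le {t N s D : ℝ} (ht : 0 ≤ t) (ht1 : t ≤ 1 / 32) (hN : 0 ≤ N)
    (hs : 0 ≤ s) (hsN : s ≤ N ^ 2 / 4) (hD0 : 1 ≤ D) (hD1 : D ≤ 1 + 2 * t ^ 2) :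
    |t ^ 2 * s * (D ^ 2 - 1) + t ^ 4 * N ^ 2 * D ^ 2 / 2 - t ^ 2 * N * (D - 1)| ≤
      2 * (t ^ 3 * (1 + N) ^ 2) := by
  have ht2 : t ^ 2 ≤ 1 / 1024 := by nlinarith
  have t34 : t ^ 4 ≤ t ^ 3 / 32 := by
    calc t ^ 4 = t ^ 3 * t := by ring
      _ ≤ t ^ 3 * (1 / 32) := by gcongr
      _ = _ := by ring
  have d1 : D - 1 ≤ 2 * t ^ 2 := by linarith
  have d2 : D ^ 2 - 1 ≤ 6 * t ^ 2 := by nlinarith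
  have d3 : D ^ 2 ≤ 2 := by nlinarith
  have d4 : 0 ≤ D ^ 2 - 1 := by nlinarith
  have d5 : 0 ≤ D - 1 := by linarith
  have b1 : t ^ 2 * s * (D ^ 2 - 1) ≤ t ^ 2 * (N ^ 2 / 4) * (6 * t ^ 2) := by gcongr
  have b2 : t ^ 4 * N ^ 2 * D ^ 2 / 2 ≤ t ^ 4 * N ^ 2 * 2 / 2 := by gcongr
  have b3 : t ^ 2 * N * (D - 1) ≤ t ^ 2 * N * (2 * t ^ 2) := by gcongr
  have b4 : 0 ≤ t ^ 2 * s * (D ^ 2 - 1) := by positivity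
  have b5 : 0 ≤ t ^ 2 * N * (D - 1) := by positivity
  have b6 : 0 ≤ t ^ 4 * N ^ 2 * D ^ 2 / 2 := by positivity
  have b7 : t ^ 4 * N ^ 2 ≤ t ^ 3 / 32 * (1 + N) ^ 2 := by gcongr; linarith
  have b8 : t ^ 4 * N ≤ t ^ 3 / 32 * (1 + N) ^ 2 := by gcongr; nlinarith
  have b9 : 0 ≤ t ^ 3 * (1 + N) ^ 2 := by positivity
  rw [abs_le]
  constructor <;> linarith

lemma abs_mul_expansion_sub_le {m C₁ t N s X G A B : ℝ} (hm : 0 ≤ m) (hC₁ : 0 ≤ C₁) (ht : 0 ≤ t)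
    (ht1 : t ≤ 1) (hN : 0 ≤ N) (hs0 : 0 ≤ s) (hsN : s ≤ N ^ 2 / 4) (hX2 : (1 + N) ^ 2 ≤ X)
    (hG0 : 0 ≤ G) (hg : |G - (1 + m * t ^ 2)| ≤ C₁ * (t ^ 2) ^ 2)
    (eAll : |A - (1 + t ^ 2 * (s - N))| ≤ B * t ^ 3 * X) :
    |G * A - (1 + t ^ 2 * (s - N + m))| ≤ (m + C₁ + (1 + m + C₁) * B) * t ^ 3 * X := by
  have ht2 : t ^ 2 ≤ 1 := by nlinarith
  have ht4 : (t ^ 2) ^ 2 ≤ 1 := by nlinarith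
  have t34 : t ^ 4 ≤ t ^ 3 := pow_le_pow_of_le_one ht ht1 (by norm_num)
  have hX0 : 0 ≤ X := (sq_nonneg _).trans hX2
  have hGle : G ≤ 1 + m + C₁ := by
    have h1 := (abs_le.1 hg).2
    have h2 : m * t ^ 2 ≤ m * 1 := by gcongr
    have h3 : C₁ * (t ^ 2) ^ 2 ≤ C₁ * 1 := by gcongr
    linarith
  have habs : |s - N| ≤ (1 + N) ^ 2 := by
    have h9 : 0 ≤ N ^ 2 := sq_nonneg N
    have h10 : (1 + N) ^ 2 = 1 + 2 * N + N ^ 2 := by ring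
    rw [abs_le]; constructor <;> linarith
  have habs1 : |1 + t ^ 2 * (s - N)| ≤ (1 + N) ^ 2 := by
    have h5 : t ^ 2 * s ≤ 1 * s := by gcongr
    have h6 : t ^ 2 * N ≤ 1 * N := by gcongr
    have h7 : 0 ≤ t ^ 2 * s := by positivity
    have h8 : 0 ≤ t ^ 2 * N := by positivity
    have h9 : 0 ≤ N ^ 2 := sq_nonneg N
    have h10 : (1 + N) ^ 2 = 1 + 2 * N + N ^ 2 := by ring
    rw [abs_le]; constructor <;> linarith
  have e : G * A - (1 + t ^ 2 * (s - N + m)) = m * t ^ 4 * (s - N)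
      + (G - (1 + m * t ^ 2)) * (1 + t ^ 2 * (s - N)) + G * (A - (1 + t ^ 2 * (s - N))) := by ring
  rw [e]
  have f1 : |m * t ^ 4 * (s - N)| ≤ m * t ^ 3 * X := by
    rw [abs_mul, abs_of_nonneg (by positivity)]
    gcongr; exact habs.trans hX2
  have f2 : |(G - (1 + m * t ^ 2)) * (1 + t ^ 2 * (s - N))| ≤ C₁ * t ^ 3 * X := by
    rw [abs_mul]
    calc _ ≤ C₁ * (t ^ 2) ^ 2 * X := by gcongr; exact habs1.trans hX2
      _ = C₁ * t ^ 4 * X := by ring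
      _ ≤ _ := by gcongr
  have f3 : |G * (A - (1 + t ^ 2 * (s - N)))| ≤ (1 + m + C₁) * (B * t ^ 3 * X) := by
    rw [abs_mul, abs_of_nonneg hG0]; gcongr
  calc _ ≤ m * t ^ 3 * X + C₁ * t ^ 3 * X + (1 + m + C₁) * (B * t ^ 3 * X) :=
        (abs_add_three _ _ _).trans (by linarith)
    _ = _ := by ring

/-- In the application `x + iy = ⟪v, w⟫` and `N = |v|² + |w|²`, so the bound on `x² + y²` is
Cauchy–Schwarz. The remainder weight `exp(N/4)` splits into one square-integrable factor per
variable. -/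
lemma exists_abs_exp_four_avg_mehler_le (n : ℕ) : ∃ C : ℝ, 0 ≤ C ∧
    ∀ t N x y : ℝ, 0 < t → t ≤ 1 / 32 → 0 ≤ N → x ^ 2 + y ^ 2 ≤ (N / 2) ^ 2 →
    |((1 - t ^ 2) ^ n)⁻¹ *
      ((Real.exp ((2 * (t * x) - t ^ 2 * N) / (1 - t ^ 2))
      + Real.exp ((2 * (-(t * x)) - t ^ 2 * N) / (1 - t ^ 2))
      + Real.exp ((2 * (t * y) - t ^ 2 * N) / (1 - t ^ 2))
      + Real.exp ((2 * (-(t * y)) - t ^ 2 * N) / (1 - t ^ 2))) / 4)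
      - (1 + t ^ 2 * (x ^ 2 + y ^ 2 - N + n))| ≤ C * t ^ 3 * Real.exp (N / 4) := by
  obtain ⟨C₁, hC₁, hG⟩ := exists_abs_inv_one_sub_pow_sub_le n
  obtain ⟨C₂, hC₂, hpoly⟩ := exists_one_add_pow_le_exp 3 (c := 1 / 8) (by norm_num)
  refine ⟨(n + C₁ + (1 + n + C₁) * 66) * C₂, by positivity, fun t N x y ht ht1 hN hxy => ?_⟩
  have ht2 : t ^ 2 ≤ 1 / 1024 := by nlinarith
  have hD : 0 < 1 - t ^ 2 := by linarith
  set D := (1 - t ^ 2)⁻¹ with hDdef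
  have hD1 : D ≤ 1 + 2 * t ^ 2 := by
    rw [hDdef, inv_le_iff_one_le_mul₀ hD]; nlinarith [sq_nonneg t]
  have hD0 : 1 ≤ D := (one_le_inv₀ hD).2 (by nlinarith)
  have hD2 : D ≤ 2 := by linarith
  set s := x ^ 2 + y ^ 2 with hs
  have hs0 : 0 ≤ s := by positivity
  set a : ℝ := -(t ^ 2 * N * D) with ha
  have key : ∀ z : ℝ, z ^ 2 ≤ (N / 2) ^ 2 → |a| + |2 * t * z * D| ≤ 4 * t * N := by
    intro z hz
    have h1 : |z| ≤ N / 2 := abs_le_of_sq_le_sq hz (by positivity)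
    rw [ha, abs_neg, abs_of_nonneg (by positivity), abs_mul, abs_mul, abs_mul, abs_two,
      abs_of_pos ht, abs_of_pos (by linarith : 0 < D)]
    have h2 : t ^ 2 ≤ t := by nlinarith
    calc t ^ 2 * N * D + 2 * t * |z| * D ≤ t * N * 2 + 2 * t * (N / 2) * 2 := by gcongr
      _ = 4 * t * N := by ring
  have h := abs_exp_four_avg_sub_le (key x (by nlinarith)) (key y (by nlinarith))
  set A := (Real.exp (a + 2 * t * x * D) + Real.exp (a - 2 * t * x * D)
    + Real.exp (a + 2 * t * y * D) + Real.exp (a - 2 * t * y * D)) / 4 with hA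
  have eA : (Real.exp ((2 * (t * x) - t ^ 2 * N) / (1 - t ^ 2))
      + Real.exp ((2 * (-(t * x)) - t ^ 2 * N) / (1 - t ^ 2))
      + Real.exp ((2 * (t * y) - t ^ 2 * N) / (1 - t ^ 2))
      + Real.exp ((2 * (-(t * y)) - t ^ 2 * N) / (1 - t ^ 2))) / 4 = A := by
    simp only [hA, ha, div_eq_mul_inv _ (1 - t ^ 2), ← hDdef]
    congr 4 <;> [skip; skip; congr 1; congr 1] <;> ring_nf
  rw [eA]
  -- The bound `t ≤ 1/32` turns `exp(4tN)` into at most `exp(N/8)`; the other `exp(N/8)` available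
  -- pays for the cubic polynomial. The constant `66` is `64 = 4³` from the Taylor remainder plus
  -- `2` from the quadratic part.
  set X := (1 + N) ^ 3 * Real.exp (N / 8) with hX
  have hexp1 : 1 ≤ Real.exp (N / 8) := Real.one_le_exp (by positivity)
  have hX2 : (1 + N) ^ 2 ≤ X := by
    calc (1 + N) ^ 2 ≤ (1 + N) ^ 3 := pow_le_pow_right₀ (by linarith) (by norm_num)
      _ = (1 + N) ^ 3 * 1 := by ring
      _ ≤ X := by rw [hX]; gcongr
  have hXle : X ≤ C₂ * Real.exp (N / 4) := by
    calc X ≤ C₂ * Real.exp (1 / 8 * N) * Real.exp (N / 8) := by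
          rw [hX]; gcongr; exact hpoly N hN
      _ = C₂ * Real.exp (N / 4) := by rw [mul_assoc, ← Real.exp_add]; ring_nf
  have t34 : t ^ 4 ≤ t ^ 3 := pow_le_pow_of_le_one ht.le (by linarith) (by norm_num)
  have hsN : s ≤ N ^ 2 / 4 := by linarith
  have eE : (4 * t * N) ^ 3 * Real.exp (4 * t * N) ≤ 64 * t ^ 3 * X := by
    have : Real.exp (4 * t * N) ≤ Real.exp (N / 8) := Real.exp_le_exp.2 (by nlinarith)
    have hN3 : N ^ 3 ≤ (1 + N) ^ 3 := by gcongr; linarith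
    calc (4 * t * N) ^ 3 * Real.exp (4 * t * N) = 64 * t ^ 3 * (N ^ 3 * Real.exp (4 * t * N)) := by
          ring
      _ ≤ 64 * t ^ 3 * X := by rw [hX]; gcongr
  have eQ : |(1 + a + a ^ 2 / 2 + ((2 * t * x * D) ^ 2 + (2 * t * y * D) ^ 2) / 4)
      - (1 + t ^ 2 * (s - N))| ≤ 2 * t ^ 3 * X := by
    have hdom : t ^ 3 * (1 + N) ^ 2 ≤ t ^ 3 * X := by gcongr
    have := abs_mehler_quadratic_sub_le ht.le ht1 hN hs0 (by nlinarith : s ≤ N ^ 2 / 4) hD0 hD1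
    have e : (1 + a + a ^ 2 / 2 + ((2 * t * x * D) ^ 2 + (2 * t * y * D) ^ 2) / 4)
      - (1 + t ^ 2 * (s - N)) = t ^ 2 * s * (D ^ 2 - 1) + t ^ 4 * N ^ 2 * D ^ 2 / 2
        - t ^ 2 * N * (D - 1) := by
      rw [ha, hs]; ring
    rw [e]
    linarith
  have eAll : |A - (1 + t ^ 2 * (s - N))| ≤ 66 * t ^ 3 * X := by
    have := abs_sub_le A (1 + a + a ^ 2 / 2 + ((2 * t * x * D) ^ 2 + (2 * t * y * D) ^ 2) / 4)
      (1 + t ^ 2 * (s - N))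
    linarith
  have hg := hG (t ^ 2) (by positivity) (by linarith)
  set G := ((1 - t ^ 2) ^ n)⁻¹ with hGdef
  calc _ ≤ (n + C₁ + (1 + n + C₁) * 66) * t ^ 3 * X :=
        abs_mul_expansion_sub_le (Nat.cast_nonneg n) hC₁ ht.le (by linarith) hN hs0 hsN hX2
          (by positivity) hg eAll
    _ ≤ (n + C₁ + (1 + n + C₁) * 66) * t ^ 3 * (C₂ * Real.exp (N / 4)) := by gcongr
    _ = _ := by ring

end estimates

/-! ### The uniform measure on angles -/

section angle

instance isProbabilityMeasure_angleMeasure : IsProbabilityMeasure angleMeasure := by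
  constructor
  rw [angleMeasure, Measure.smul_apply, Measure.restrict_apply_univ, Real.volume_Ioc, smul_eq_mul,
    sub_neg_eq_add, ← two_mul, ENNReal.inv_mul_cancel]
  · simp [Real.pi_pos]
  · exact ENNReal.ofReal_ne_top

lemma integral_angleMeasure (φ : ℝ → ℝ) :
    ∫ θ, φ θ ∂angleMeasure = (2 * Real.pi)⁻¹ * ∫ θ in (-Real.pi)..Real.pi, φ θ := by
  rw [angleMeasure, integral_smul_measure, intervalIntegral.integral_of_le (by linarith [Real.pi_pos]),
    ENNReal.toReal_inv, ENNReal.toReal_ofReal (by positivity)]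
  rfl

lemma integral_angleMeasure_rotate (φ : ℂ → ℝ) {c : ℂ} (hc : ‖c‖ = 1) :
    ∫ θ : ℝ, φ (c * cexp (θ * I)) ∂angleMeasure = ∫ θ : ℝ, φ (cexp (θ * I)) ∂angleMeasure := by
  rw [integral_angleMeasure, integral_angleMeasure]
  congr 1
  have hp : Function.Periodic (fun θ : ℝ => φ (cexp (θ * I))) (2 * Real.pi) := by
    intro θ
    have : ((θ + 2 * Real.pi : ℝ) : ℂ) * I = θ * I + 2 * Real.pi * I := by push_cast; ring
    simp only [this, Complex.exp_add, Complex.exp_two_pi_mul_I, mul_one]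
  have h1 : ∀ θ : ℝ, φ (c * cexp (θ * I)) = (fun θ : ℝ => φ (cexp (θ * I))) (θ + arg c) := by
    intro θ
    have : c = cexp (arg c * I) := by
      conv_lhs => rw [← Complex.norm_mul_exp_arg_mul_I c, hc]
      simp
    conv_lhs => rw [this, ← Complex.exp_add]
    simp only [ofReal_add]
    congr 2
    ring
  simp_rw [h1]
  rw [intervalIntegral.integral_comp_add_right (fun θ : ℝ => φ (cexp (θ * I)))]
  have := hp.intervalIntegral_add_eq (-Real.pi + arg c) (-Real.pi)
  convert this using 2 <;> ring

end angle

lemma nonneg_of_forall_pos_small {D K ε₀ : ℝ} (hε₀ : 0 < ε₀) (hK : 0 ≤ K)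
    (h : ∀ ε : ℝ, 0 < ε → ε ≤ ε₀ → 0 ≤ D + ε * K) : 0 ≤ D := by
  refine le_of_forall_pos_le_add fun δ hδ => ?_
  refine (h (min ε₀ (δ / (K + 1))) (lt_min hε₀ (by positivity)) (min_le_left _ _)).trans ?_
  have h1 : min ε₀ (δ / (K + 1)) * K ≤ δ / (K + 1) * (K + 1) :=
    mul_le_mul (min_le_right _ _) (by linarith) hK (by positivity)
  rw [div_mul_cancel₀ _ (by positivity)] at h1
  linarith

section fourAvg
variable {α : Type*} [MeasurableSpace α] {μ : Measure α} {f₁ f₂ f₃ f₄ : α → ℝ}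

lemma integrable_four_avg (h₁ : Integrable f₁ μ) (h₂ : Integrable f₂ μ) (h₃ : Integrable f₃ μ)
    (h₄ : Integrable f₄ μ) : Integrable (fun x => (f₁ x + f₂ x + f₃ x + f₄ x) / 4) μ :=
  (((h₁.add h₂).add h₃).add h₄).div_const 4

lemma integral_four_avg (h₁ : Integrable f₁ μ) (h₂ : Integrable f₂ μ) (h₃ : Integrable f₃ μ)
    (h₄ : Integrable f₄ μ) : ∫ x, (f₁ x + f₂ x + f₃ x + f₄ x) / 4 ∂μ =
      (∫ x, f₁ x ∂μ + ∫ x, f₂ x ∂μ + ∫ x, f₃ x ∂μ + ∫ x, f₄ x ∂μ) / 4 := by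
  have h12 : Integrable (fun x => f₁ x + f₂ x) μ := h₁.add h₂
  have h123 : Integrable (fun x => f₁ x + f₂ x + f₃ x) μ := h12.add h₃
  rw [integral_div, integral_add h123 h₄, integral_add h12 h₃, integral_add h₁ h₂]

end fourAvg

/-! ### Gaussian translation and positivity of the second-order coefficients -/

section translate
variable {n : ℕ}

/-- This weight dominates every error term below, and by Hölder its product with any `L²` function
is integrable. -/
lemma memLp_exp_norm_sq :
    MemLp (fun v : EuclideanSpace ℂ (Fin n) => Real.exp (‖v‖ ^ 2 / 4)) 2 (complexGaussian n) := by
  rw [memLp_two_iff_integrable_sq (by fun_prop)]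
  rw [complexGaussian, integrable_withDensity_iff_integrable_smul' (by fun_prop) (by simp)]
  have h := (GaussianFourier.integrable_cexp_neg_mul_sq_norm_add (b := 1 / 2)
    (by norm_num) 0 (0 : EuclideanSpace ℂ (Fin n))).re.const_mul (Real.pi ^ n)⁻¹
  refine h.congr (ae_of_all _ fun v => ?_)
  simp only
  rw [ENNReal.toReal_ofReal (by positivity), smul_eq_mul, ← Real.exp_nat_mul, mul_assoc,
    ← Real.exp_add]
  congr 1
  have : -(1 / 2 : ℂ) * (‖v‖ : ℂ) ^ 2 + 0 * (inner ℝ (0 : EuclideanSpace ℂ (Fin n)) v : ℝ) =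
      ((-‖v‖ ^ 2 + (2 : ℕ) * (‖v‖ ^ 2 / 4) : ℝ) : ℂ) := by
    push_cast
    ring
  rw [this, ← Complex.ofReal_exp, RCLike.re_to_complex, ofReal_re]

lemma map_add_complexGaussian (m : EuclideanSpace ℂ (Fin n)) :
    (complexGaussian n).map (fun w => w + m) = (complexGaussian n).withDensity
      fun y => ENNReal.ofReal (Real.exp (2 * (inner ℂ m y).re - ‖m‖ ^ 2)) := by
  have h := map_add_smul_complexGaussian m one_pos
  simp only [one_smul, one_pow, inv_one, one_mul, div_one] at h
  simp_rw [add_comm _ m]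
  rw [h]
  congr 1
  funext y
  rw [@norm_sub_sq ℂ, ← inner_conj_symm, RCLike.re_to_complex, Complex.conj_re]
  congr 2
  ring

lemma integral_add_complexGaussian {h : EuclideanSpace ℂ (Fin n) → ℝ} (hm : Measurable h)
    (m : EuclideanSpace ℂ (Fin n)) : ∫ v, h (v + m) ∂(complexGaussian n) =
      ∫ v, Real.exp (2 * (inner ℂ m v).re - ‖m‖ ^ 2) * h v ∂(complexGaussian n) := by
  have e := integral_map (μ := complexGaussian n) (φ := fun w => w + m) (by fun_prop)
    hm.aestronglyMeasurable
  rw [← e, map_add_complexGaussian, integral_withDensity_eq_integral_toReal_smul (by fun_prop)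
    (by simp)]
  refine integral_congr_ae (ae_of_all _ fun v => ?_)
  simp only
  rw [ENNReal.toReal_ofReal (by positivity), smul_eq_mul]

lemma integrable_add_complexGaussian_iff {h : EuclideanSpace ℂ (Fin n) → ℝ} (hm : Measurable h)
    (m : EuclideanSpace ℂ (Fin n)) : Integrable (fun v => h (v + m)) (complexGaussian n) ↔
      Integrable (fun v => Real.exp (2 * (inner ℂ m v).re - ‖m‖ ^ 2) * h v) (complexGaussian n) := by
  have e := integrable_map_measure (μ := complexGaussian n) (f := fun w => w + m)
    hm.aestronglyMeasurable (by fun_prop)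
  rw [map_add_complexGaussian, integrable_withDensity_iff_integrable_smul' (by fun_prop)
    (by simp)] at e
  rw [Function.comp_def] at e
  rw [← e]
  refine integrable_congr (ae_of_all _ fun v => ?_)
  simp only
  rw [ENNReal.toReal_ofReal (by positivity), smul_eq_mul]

lemma exp_translate_le (m v : EuclideanSpace ℂ (Fin n)) :
    Real.exp (2 * (inner ℂ m v).re - ‖m‖ ^ 2) ≤ Real.exp (3 * ‖m‖ ^ 2) * Real.exp (‖v‖ ^ 2 / 4) := by
  rw [← Real.exp_add]
  have h : (inner ℂ m v).re ≤ ‖m‖ * ‖v‖ := (re_le_norm _).trans (norm_inner_le_norm m v)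
  apply Real.exp_le_exp.2
  nlinarith [sq_nonneg (2 * ‖m‖ - ‖v‖ / 2)]

lemma integrable_exp_translate_mul {h : EuclideanSpace ℂ (Fin n) → ℝ}
    (h2 : MemLp h 2 (complexGaussian n)) (m : EuclideanSpace ℂ (Fin n)) :
    Integrable (fun v => Real.exp (2 * (inner ℂ m v).re - ‖m‖ ^ 2) * h v) (complexGaussian n) := by
  have hb : Integrable (fun v => Real.exp (‖v‖ ^ 2 / 4) * h v) (complexGaussian n) :=
    (memLp_exp_norm_sq (n := n)).integrable_mul h2
  refine (hb.const_mul (Real.exp (3 * ‖m‖ ^ 2))).mono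
    ((by fun_prop : Continuous fun v : EuclideanSpace ℂ (Fin n) =>
      Real.exp (2 * (inner ℂ m v).re - ‖m‖ ^ 2)).aestronglyMeasurable.mul h2.1)
    (ae_of_all _ fun v => ?_)
  simp only [norm_mul, Real.norm_eq_abs, Real.abs_exp]
  rw [← mul_assoc]
  gcongr
  exact exp_translate_le m v

lemma integral_norm_add_le {h : EuclideanSpace ℂ (Fin n) → ℝ} (hm : Measurable h)
    (h2 : MemLp h 2 (complexGaussian n)) (m : EuclideanSpace ℂ (Fin n)) :
    ∫ v, ‖h (v + m)‖ ∂(complexGaussian n) ≤ Real.exp (3 * ‖m‖ ^ 2) *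
      ∫ v, Real.exp (‖v‖ ^ 2 / 4) * ‖h v‖ ∂(complexGaussian n) := by
  have hb := (memLp_exp_norm_sq (n := n)).integrable_mul h2.norm
  rw [integral_add_complexGaussian hm.norm, ← integral_const_mul]
  refine integral_mono (integrable_exp_translate_mul h2.norm m) (hb.const_mul _) fun v => ?_
  simp only
  rw [← mul_assoc]
  gcongr
  exact exp_translate_le m v

/-- The translated `L¹` norm is bounded in terms of `‖m‖` alone, hence uniformly along the circle.
-/
lemma integrable_prod_angle {h : EuclideanSpace ℂ (Fin n) → ℝ} (hm : Measurable h)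
    (h2 : MemLp h 2 (complexGaussian n)) (u : EuclideanSpace ℂ (Fin n)) :
    Integrable (fun p : EuclideanSpace ℂ (Fin n) × ℝ => h (p.1 + cexp (p.2 * I) • u))
      ((complexGaussian n).prod angleMeasure) := by
  have hmap : Measurable (fun p : EuclideanSpace ℂ (Fin n) × ℝ => p.1 + cexp (p.2 * I) • u) := by
    fun_prop
  have hmeas : Measurable (fun p : EuclideanSpace ℂ (Fin n) × ℝ => h (p.1 + cexp (p.2 * I) • u)) :=
    hm.comp hmap
  have hmeas' : StronglyMeasurable fun θ : ℝ =>
      ∫ v, ‖h (v + cexp (θ * I) • u)‖ ∂(complexGaussian n) :=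
    StronglyMeasurable.integral_prod_left (μ := complexGaussian n)
      (f := fun v (θ : ℝ) => ‖h (v + cexp (θ * I) • u)‖) hmeas.norm.stronglyMeasurable
  refine (integrable_prod_iff' hmeas.aestronglyMeasurable).2
    ⟨ae_of_all _ fun θ => (integrable_add_complexGaussian_iff hm (cexp (θ * I) • u)).2
    (integrable_exp_translate_mul h2 (cexp (θ * I) • u)), ?_⟩
  refine Integrable.of_bound hmeas'.aestronglyMeasurable
    (Real.exp (3 * ‖u‖ ^ 2) *
      ∫ v, Real.exp (‖v‖ ^ 2 / 4) * ‖h v‖ ∂(complexGaussian n)) (ae_of_all _ fun θ => ?_)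
  rw [Real.norm_eq_abs, abs_of_nonneg (integral_nonneg fun _ => norm_nonneg _)]
  refine (integral_norm_add_le hm h2 (cexp (θ * I) • u)).trans ?_
  rw [norm_smul, Complex.norm_exp_ofReal_mul_I, one_mul]

lemma inner_smul_re_pair (c : ℂ) (hc : ‖c‖ = 1) (u v : EuclideanSpace ℂ (Fin n)) :
    (inner ℂ (c • u) v).re ^ 2 + (inner ℂ ((I * c) • u) v).re ^ 2 = ‖inner ℂ u v‖ ^ 2 := by
  have h : (inner ℂ ((I * c) • u) v : ℂ) = -I * inner ℂ (c • u) v := by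
    rw [inner_smul_left, inner_smul_left, map_mul, Complex.conj_I, mul_assoc]
  have h1 : ‖(inner ℂ (c • u) v : ℂ)‖ = ‖(inner ℂ u v : ℂ)‖ := by
    rw [inner_smul_left, norm_mul, RCLike.norm_conj, hc, one_mul]
  rw [h, ← h1, Complex.sq_norm, Complex.normSq_apply]
  simp
  ring

/-- A function satisfying the sub-mean value inequality along circles correlates nonnegatively with
`|⟪u, v⟫|² - |u|²` under the Gaussian. -/
lemma integral_mul_norm_inner_sq_sub_nonneg {h : EuclideanSpace ℂ (Fin n) → ℝ} (hm : Measurable h)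
    (h2 : MemLp h 2 (complexGaussian n))
    (hsub : ∀ u : EuclideanSpace ℂ (Fin n), ∀ᵐ v ∂(complexGaussian n),
      Integrable (fun θ : ℝ => h (v + cexp (θ * I) • u)) angleMeasure →
      h v ≤ ∫ θ : ℝ, h (v + cexp (θ * I) • u) ∂angleMeasure) (u : EuclideanSpace ℂ (Fin n)) :
    0 ≤ ∫ v, h v * (‖inner ℂ u v‖ ^ 2 - ‖u‖ ^ 2) ∂(complexGaussian n) := by
  obtain ⟨C, hC, hexp⟩ := exists_abs_exp_four_avg_translate_le (‖u‖ ^ 2) (by positivity)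
  set D := ∫ v, h v * (‖inner ℂ u v‖ ^ 2 - ‖u‖ ^ 2) ∂(complexGaussian n) with hD
  have hb : Integrable (fun v => Real.exp (‖v‖ ^ 2 / 4) * ‖h v‖) (complexGaussian n) :=
    (memLp_exp_norm_sq (n := n)).integrable_mul h2.norm
  have h1 : Integrable h (complexGaussian n) := h2.integrable (by norm_num)
  set B := ∫ v, Real.exp (‖v‖ ^ 2 / 4) * ‖h v‖ ∂(complexGaussian n) with hB
  have hB0 : 0 ≤ B := integral_nonneg fun v => by positivity
  have hDint : Integrable (fun v => h v * (‖inner ℂ u v‖ ^ 2 - ‖u‖ ^ 2)) (complexGaussian n) := by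
    refine (hb.const_mul (5 * ‖u‖ ^ 2)).mono (h2.1.mul
      (by fun_prop : Continuous fun v : EuclideanSpace ℂ (Fin n) =>
        ‖(inner ℂ u v : ℂ)‖ ^ 2 - ‖u‖ ^ 2).aestronglyMeasurable) (ae_of_all _ fun v => ?_)
    rw [norm_mul, Real.norm_eq_abs (5 * ‖u‖ ^ 2 * _), abs_of_nonneg (by positivity), ← mul_assoc,
      mul_comm ‖h v‖]
    gcongr
    have e1 : ‖(inner ℂ u v : ℂ)‖ ^ 2 ≤ ‖u‖ ^ 2 * ‖v‖ ^ 2 := by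
      rw [← mul_pow]; gcongr; exact norm_inner_le_norm u v
    have e2 : ‖v‖ ^ 2 / 4 + 1 ≤ Real.exp (‖v‖ ^ 2 / 4) := Real.add_one_le_exp _
    have e3 : 0 ≤ ‖(inner ℂ u v : ℂ)‖ ^ 2 := by positivity
    have e4 : ‖u‖ ^ 2 * (‖v‖ ^ 2 / 4 + 1) ≤ ‖u‖ ^ 2 * Real.exp (‖v‖ ^ 2 / 4) := by gcongr
    have e5 : 0 ≤ ‖u‖ ^ 2 * ‖v‖ ^ 2 := by positivity
    have e6 : 0 ≤ ‖u‖ ^ 2 := by positivity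
    rw [Real.norm_eq_abs, abs_le]
    constructor <;> nlinarith
  have main : ∀ ε : ℝ, 0 < ε → ε ≤ 1 → 0 ≤ D + ε * (C * B) := by
    intro ε hε hε1
    set J : ℂ → ℝ := fun c => ∫ v, h (v + c • (ε • u)) ∂(complexGaussian n) with hJ
    have hprod := integrable_prod_angle hm h2 (ε • u)
    -- Integrate the sub-mean value inequality over `v` and exchange the integrals.
    have s1 : ∫ v, h v ∂(complexGaussian n) ≤ ∫ θ : ℝ, J (cexp (θ * I)) ∂angleMeasure := by
      rw [hJ]
      have := integral_integral_swap
        (f := fun (v : EuclideanSpace ℂ (Fin n)) (θ : ℝ) => h (v + cexp (θ * I) • ε • u)) hprod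
      simp only at this ⊢
      rw [← this]
      refine integral_mono_ae h1 hprod.integral_prod_left ?_
      filter_upwards [hsub (ε • u), hprod.prod_right_ae] with v hv hv'
      exact hv hv'
    have hJint : Integrable (fun θ : ℝ => J (cexp (θ * I))) angleMeasure := hprod.integral_prod_right
    have hJint' : ∀ c : ℂ, ‖c‖ = 1 → Integrable (fun θ : ℝ => J (c * cexp (θ * I))) angleMeasure := by
      intro c hc
      have := (integrable_prod_angle hm h2 (c • (ε • u))).integral_prod_right
      refine this.congr (ae_of_all _ fun θ => ?_)
      simp only [hJ, smul_smul, mul_comm c]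
    -- Move the translation onto the density. Over `±c, ±ic` the pairings with `v` are plus and
    -- minus the real parts for `c` and `ic`, whose squares add up to `‖⟪u, v⟫‖²` whatever `c` is.
    have s2 : ∀ c : ℂ, ‖c‖ = 1 → (J c + J (-1 * c) + J (I * c) + J (-I * c)) / 4 ≤
        ∫ v, h v ∂(complexGaussian n) + ε ^ 2 * D + C * ε ^ 3 * B := by
      intro c hc
      have key : ∀ d : ℂ, ‖d‖ = 1 → J d = ∫ v, Real.exp (-(ε ^ 2 * ‖u‖ ^ 2) +
          2 * ε * (inner ℂ (d • u) v).re) * h v ∂(complexGaussian n) ∧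
          Integrable (fun v => Real.exp (-(ε ^ 2 * ‖u‖ ^ 2) +
          2 * ε * (inner ℂ (d • u) v).re) * h v) (complexGaussian n) := by
        intro d hd
        have e : ∀ v : EuclideanSpace ℂ (Fin n),
            2 * (inner ℂ (d • (ε • u)) v).re - ‖d • (ε • u)‖ ^ 2 =
            -(ε ^ 2 * ‖u‖ ^ 2) + 2 * ε * (inner ℂ (d • u) v).re := by
          intro v
          rw [norm_smul, norm_smul, hd, smul_comm, ← Complex.coe_smul ε, inner_smul_left]
          simp only [conj_ofReal, re_ofReal_mul, Real.norm_eq_abs, mul_pow, sq_abs]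
          ring
        have i := integrable_exp_translate_mul h2 (d • (ε • u))
        simp_rw [e] at i
        refine ⟨?_, i⟩
        rw [hJ]
        simp only
        rw [integral_add_complexGaussian hm]
        simp_rw [e]
      have n1 : ‖-1 * c‖ = 1 := by simp [hc]
      have n2 : ‖I * c‖ = 1 := by simp [hc]
      have n3 : ‖-I * c‖ = 1 := by simp [hc]
      obtain ⟨k1, i1⟩ := key c hc
      obtain ⟨k2, i2⟩ := key _ n1
      obtain ⟨k3, i3⟩ := key _ n2
      obtain ⟨k4, i4⟩ := key _ n3
      have hR : Integrable (fun v => h v + ε ^ 2 * (h v * (‖inner ℂ u v‖ ^ 2 - ‖u‖ ^ 2)))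
          (complexGaussian n) := h1.add (hDint.const_mul _)
      rw [k1, k2, k3, k4, ← integral_four_avg i1 i2 i3 i4, hD, hB, ← integral_const_mul,
        ← integral_const_mul, ← integral_add h1 (hDint.const_mul _),
        ← integral_add hR (hb.const_mul _)]
      refine integral_mono (integrable_four_avg i1 i2 i3 i4) (hR.add (hb.const_mul _)) fun v => ?_
      have hx := inner_smul_re_pair c hc u v
      have hle : ‖(inner ℂ u v : ℂ)‖ ^ 2 ≤ ‖u‖ ^ 2 * ‖v‖ ^ 2 := by
        rw [← mul_pow]; gcongr; exact norm_inner_le_norm u v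
      have hk := hexp ε (‖v‖ ^ 2) (inner ℂ (c • u) v).re (inner ℂ ((I * c) • u) v).re hε hε1
        (by positivity) (by rw [hx]; exact hle)
      rw [hx] at hk
      have m1 : (inner ℂ ((-1 * c) • u) v).re = -(inner ℂ (c • u) v).re := by
        rw [neg_one_mul, neg_smul, inner_neg_left, neg_re]
      have m2 : (inner ℂ ((-I * c) • u) v).re = -(inner ℂ ((I * c) • u) v).re := by
        rw [neg_mul, neg_smul, inner_neg_left, neg_re]
      simp only [m1, m2, mul_neg, ← sub_eq_add_neg]
      set K := (Real.exp (-(ε ^ 2 * ‖u‖ ^ 2) + 2 * ε * (inner ℂ (c • u) v).re)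
        + Real.exp (-(ε ^ 2 * ‖u‖ ^ 2) - 2 * ε * (inner ℂ (c • u) v).re)
        + Real.exp (-(ε ^ 2 * ‖u‖ ^ 2) + 2 * ε * (inner ℂ ((I * c) • u) v).re)
        + Real.exp (-(ε ^ 2 * ‖u‖ ^ 2) - 2 * ε * (inner ℂ ((I * c) • u) v).re)) / 4 with hK
      have hfin : (K - (1 + ε ^ 2 * (‖(inner ℂ u v : ℂ)‖ ^ 2 - ‖u‖ ^ 2))) * h v ≤
          C * ε ^ 3 * Real.exp (‖v‖ ^ 2 / 4) * ‖h v‖ := by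
        refine (le_abs_self _).trans ?_
        rw [abs_mul, Real.norm_eq_abs]
        gcongr
      calc _ = K * h v := by rw [hK]; ring
        _ ≤ _ := by linarith
    -- By rotation invariance the circle average of `J` is the average of its four-point averages,
    -- so the bound for each `c` integrates.
    have s3 : ∫ θ : ℝ, J (cexp (θ * I)) ∂angleMeasure ≤
        ∫ v, h v ∂(complexGaussian n) + ε ^ 2 * D + C * ε ^ 3 * B := by
      have r1 := integral_angleMeasure_rotate J (c := -1) (by simp)
      have r2 := integral_angleMeasure_rotate J (c := I) (by simp)
      have r3 := integral_angleMeasure_rotate J (c := -I) (by simp)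
      have i1 := hJint' (-1) (by simp)
      have i2 := hJint' I (by simp)
      have i3 := hJint' (-I) (by simp)
      have e : ∫ θ : ℝ, J (cexp (θ * I)) ∂angleMeasure = ∫ θ : ℝ, (J (cexp (θ * I)) +
          J (-1 * cexp (θ * I)) + J (I * cexp (θ * I)) + J (-I * cexp (θ * I))) / 4
          ∂angleMeasure := by
        rw [integral_four_avg hJint i1 i2 i3, r1, r2, r3]
        ring
      rw [e]
      refine (integral_mono (integrable_four_avg hJint i1 i2 i3) (integrable_const _)
        fun θ => s2 (cexp (θ * I)) (Complex.norm_exp_ofReal_mul_I θ)).trans ?_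
      simp
    have : 0 ≤ ε ^ 2 * (D + ε * (C * B)) := by linarith
    exact nonneg_of_mul_nonneg_right this (by positivity)
  exact nonneg_of_forall_pos_small one_pos (by positivity) main

end translate

/-! ### The chaos matrix and positivity of the quadratic pairing -/

section form
variable {n : ℕ}

/-- The quadratic kernel that appears as the second-order coefficient of the Mehler kernel. -/
noncomputable def quadKernel (v w : EuclideanSpace ℂ (Fin n)) : ℝ :=
  ‖(inner ℂ v w : ℂ)‖ ^ 2 - ‖v‖ ^ 2 - ‖w‖ ^ 2 + n

lemma integrable_exp_mul {g : EuclideanSpace ℂ (Fin n) → ℝ} (hg : MemLp g 2 (complexGaussian n)) :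
    Integrable (fun v => Real.exp (‖v‖ ^ 2 / 4) * g v) (complexGaussian n) :=
  (memLp_exp_norm_sq (n := n)).integrable_mul hg

lemma integrable_mul_of_norm_le {F : Type*} [NormedAddCommGroup F] [NormedSpace ℝ F]
    {g : EuclideanSpace ℂ (Fin n) → ℝ}
    (hg : MemLp g 2 (complexGaussian n)) {p : EuclideanSpace ℂ (Fin n) → F} (hp : Continuous p)
    (C : ℝ) (hC : ∀ w, ‖p w‖ ≤ C * (1 + ‖w‖ ^ 2)) :
    Integrable (fun w => g w • p w) (complexGaussian n) := by
  have hC0 : 0 ≤ C := by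
    have := (norm_nonneg _).trans (hC 0)
    simpa using this
  refine ((integrable_exp_mul hg).const_mul (4 * C)).mono (hg.1.smul hp.aestronglyMeasurable)
    (ae_of_all _ fun w => ?_)
  rw [norm_smul, norm_mul (4 * C), norm_mul (Real.exp _), Real.norm_eq_abs (4 * C),
    abs_of_nonneg (by positivity), Real.norm_eq_abs (Real.exp _), Real.abs_exp, mul_comm, ← mul_assoc]
  gcongr
  refine (hC w).trans ?_
  have e2 : ‖w‖ ^ 2 / 4 + 1 ≤ Real.exp (‖w‖ ^ 2 / 4) := Real.add_one_le_exp _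
  nlinarith

/-- The matrix of second-order chaos coefficients `∫ g(w) (w_i w̄_j - δ_ij) dγ`. -/
noncomputable def chaosMatrix (g : EuclideanSpace ℂ (Fin n) → ℝ) : Matrix (Fin n) (Fin n) ℂ :=
  .of fun i j => ∫ w, g w • (w i * conj (w j) - (1 : Matrix (Fin n) (Fin n) ℂ) i j) ∂(complexGaussian n)

lemma chaosMatrix_apply (g : EuclideanSpace ℂ (Fin n) → ℝ) (i j : Fin n) : chaosMatrix g i j =
    ∫ w, g w • (w i * conj (w j) - (1 : Matrix (Fin n) (Fin n) ℂ) i j) ∂(complexGaussian n) := rfl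

lemma abs_norm_inner_sq_sub_le (v w : EuclideanSpace ℂ (Fin n)) :
    |‖(inner ℂ v w : ℂ)‖ ^ 2 - ‖v‖ ^ 2| ≤ ‖v‖ ^ 2 * (1 + ‖w‖ ^ 2) := by
  have : ‖(inner ℂ v w : ℂ)‖ ^ 2 ≤ ‖v‖ ^ 2 * ‖w‖ ^ 2 := by
    rw [← mul_pow]; gcongr; exact norm_inner_le_norm v w
  have h0 : 0 ≤ ‖(inner ℂ v w : ℂ)‖ ^ 2 := by positivity
  have h1 : 0 ≤ ‖v‖ ^ 2 * ‖w‖ ^ 2 := by positivity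
  have h2 : 0 ≤ ‖v‖ ^ 2 := by positivity
  rw [abs_le]
  constructor <;> linarith

lemma integrable_chaos {g : EuclideanSpace ℂ (Fin n) → ℝ} (hg : MemLp g 2 (complexGaussian n))
    (i j : Fin n) : Integrable (fun w : EuclideanSpace ℂ (Fin n) =>
      g w • (w i * conj (w j) - (1 : Matrix (Fin n) (Fin n) ℂ) i j)) (complexGaussian n) := by
  refine integrable_mul_of_norm_le hg (by fun_prop) 1 fun w => ?_
  refine (norm_sub_le _ _).trans ?_
  rw [norm_mul, RCLike.norm_conj]
  have h1 := PiLp.norm_apply_le w i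
  have h2 := PiLp.norm_apply_le w j
  have h3 : ‖(1 : Matrix (Fin n) (Fin n) ℂ) i j‖ ≤ 1 := by
    rw [Matrix.one_apply]; split_ifs <;> simp
  have h4 : ‖w i‖ * ‖w j‖ ≤ ‖w‖ * ‖w‖ := by gcongr
  nlinarith

lemma inner_eq_sum (x w : EuclideanSpace ℂ (Fin n)) : inner ℂ x w = ∑ i, conj (x i) * w i := by
  rw [PiLp.inner_apply]
  simp [mul_comm]

lemma norm_inner_sq_eq_sum (x w : EuclideanSpace ℂ (Fin n)) :
    ((‖(inner ℂ x w : ℂ)‖ ^ 2 : ℝ) : ℂ) = ∑ i, ∑ j, conj (x i) * (w i * conj (w j)) * x j := by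
  push_cast
  rw [← Complex.mul_conj', inner_eq_sum, map_sum, Finset.sum_mul_sum]
  refine Finset.sum_congr rfl fun i _ => Finset.sum_congr rfl fun j _ => ?_
  simp only [map_mul, Complex.conj_conj]
  ring

lemma norm_sq_eq_sum_complex (x : EuclideanSpace ℂ (Fin n)) :
    ((‖x‖ ^ 2 : ℝ) : ℂ) = ∑ i, conj (x i) * x i := by
  rw [← inner_eq_sum, inner_self_eq_norm_sq_to_K]
  simp

lemma quadratic_form_chaosMatrix {g : EuclideanSpace ℂ (Fin n) → ℝ}
    (hg : MemLp g 2 (complexGaussian n)) (x : EuclideanSpace ℂ (Fin n)) :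
    ∑ i, ∑ j, conj (x i) * chaosMatrix g i j * x j =
      ((∫ w, g w * (‖(inner ℂ x w : ℂ)‖ ^ 2 - ‖x‖ ^ 2) ∂(complexGaussian n) : ℝ) : ℂ) := by
  rw [← integral_complex_ofReal]
  have e : ∀ w : EuclideanSpace ℂ (Fin n),
      ((g w * (‖(inner ℂ x w : ℂ)‖ ^ 2 - ‖x‖ ^ 2) : ℝ) : ℂ) = ∑ i, ∑ j, conj (x i) *
        (g w • (w i * conj (w j) - (1 : Matrix (Fin n) (Fin n) ℂ) i j)) * x j := by
    intro w
    rw [ofReal_mul, ofReal_sub, norm_inner_sq_eq_sum, norm_sq_eq_sum_complex,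
      ← Finset.sum_sub_distrib, Finset.mul_sum]
    refine Finset.sum_congr rfl fun i _ => ?_
    simp only [Complex.real_smul, mul_sub, sub_mul, Finset.sum_sub_distrib]
    congr 1
    · rw [Finset.mul_sum]
      refine Finset.sum_congr rfl fun j _ => by ring
    · simp [Matrix.one_apply]
      ring
  simp_rw [e]
  have hi : ∀ i j, Integrable (fun w : EuclideanSpace ℂ (Fin n) => conj (x i) *
      (g w • (w i * conj (w j) - (1 : Matrix (Fin n) (Fin n) ℂ) i j)) * x j) (complexGaussian n) :=
    fun i j => ((integrable_chaos hg i j).const_mul _).mul_const _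
  rw [integral_finsetSum _ fun i _ => integrable_finsetSum _ fun j _ => hi i j]
  refine Finset.sum_congr rfl fun i _ => ?_
  rw [integral_finsetSum _ fun j _ => hi i j]
  refine Finset.sum_congr rfl fun j _ => ?_
  rw [integral_mul_const, integral_const_mul]
  rfl

lemma trace_chaosMatrix {g : EuclideanSpace ℂ (Fin n) → ℝ}
    (hg : MemLp g 2 (complexGaussian n)) :
    ∑ i, chaosMatrix g i i =
      ((∫ w, g w * (‖w‖ ^ 2 - n) ∂(complexGaussian n) : ℝ) : ℂ) := by
  rw [← integral_complex_ofReal]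
  have e : ∀ w : EuclideanSpace ℂ (Fin n), ((g w * (‖w‖ ^ 2 - n) : ℝ) : ℂ) =
      ∑ i, g w • (w i * conj (w i) - (1 : Matrix (Fin n) (Fin n) ℂ) i i) := by
    intro w
    rw [ofReal_mul, ofReal_sub, norm_sq_eq_sum_complex]
    simp [← Finset.mul_sum, mul_comm]
  simp_rw [e]
  rw [integral_finsetSum _ fun i _ => integrable_chaos hg i i]
  rfl

lemma posSemidef_chaosMatrix {g : EuclideanSpace ℂ (Fin n) → ℝ}
    (hg : MemLp g 2 (complexGaussian n))
    (h : ∀ u, 0 ≤ ∫ w, g w * (‖(inner ℂ u w : ℂ)‖ ^ 2 - ‖u‖ ^ 2) ∂(complexGaussian n)) :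
    (chaosMatrix g).PosSemidef := by
  refine Matrix.PosSemidef.of_dotProduct_mulVec_nonneg ?_ fun x => ?_
  · ext i j
    rw [Matrix.conjTranspose_apply, chaosMatrix_apply, chaosMatrix_apply, RCLike.star_def, ← integral_conj]
    refine integral_congr_ae (ae_of_all _ fun w => ?_)
    rcases eq_or_ne i j with rfl | hij
    · simp [mul_comm]
    · simp [hij, hij.symm, mul_comm]
  · have := quadratic_form_chaosMatrix hg (WithLp.toLp 2 x)
    have e : star x ⬝ᵥ (chaosMatrix g).mulVec x =
        ∑ i, ∑ j, conj (x i) * chaosMatrix g i j * x j := by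
      simp only [dotProduct, Matrix.mulVec, Finset.mul_sum, Pi.star_apply, RCLike.star_def, mul_assoc]
    rw [e]
    simp only at this
    rw [this]
    exact_mod_cast h _

/-- Since `q(v, w) = (|⟪v, w⟫|² - |v|²) - (|w|² - n)`, the integral is `v*Av - tr A` for the chaos
matrix `A` of `g`. Positivity of `A` lets it be written as `∑ b_k b_k*`. -/
lemma exists_integral_quadKernel_eq {g : EuclideanSpace ℂ (Fin n) → ℝ}
    (hg : MemLp g 2 (complexGaussian n))
    (h : ∀ u, 0 ≤ ∫ w, g w * (‖(inner ℂ u w : ℂ)‖ ^ 2 - ‖u‖ ^ 2) ∂(complexGaussian n)) :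
    ∃ (m : ℕ) (b : Fin m → EuclideanSpace ℂ (Fin n)), ∀ v,
      ∫ w, g w * quadKernel v w ∂(complexGaussian n) =
        ∑ k, (‖(inner ℂ (b k) v : ℂ)‖ ^ 2 - ‖b k‖ ^ 2) := by
  obtain ⟨m, b, hb⟩ := (Matrix.posSemidef_iff_eq_sum_vecMulVec (𝕜 := ℂ)).1 (posSemidef_chaosMatrix hg h)
  have hb' : ∀ i j, chaosMatrix g i j = ∑ k, b k i * conj (b k j) := by
    intro i j
    rw [hb, Matrix.sum_apply]
    rfl
  refine ⟨m, fun k => WithLp.toLp 2 (b k), fun v => ?_⟩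
  have i1 : Integrable (fun w => g w * (‖(inner ℂ v w : ℂ)‖ ^ 2 - ‖v‖ ^ 2)) (complexGaussian n) := by
    refine integrable_mul_of_norm_le (F := ℝ) hg (by fun_prop) (‖v‖ ^ 2) fun w => ?_
    exact abs_norm_inner_sq_sub_le v w
  have i2 : Integrable (fun w => g w * (‖w‖ ^ 2 - n)) (complexGaussian n) := by
    refine integrable_mul_of_norm_le (F := ℝ) hg (by fun_prop) (n + 1) fun w => ?_
    have h1 : 0 ≤ (n : ℝ) * ‖w‖ ^ 2 := by positivity
    have h2 : 0 ≤ ‖w‖ ^ 2 := by positivity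
    have h3 : (0 : ℝ) ≤ n := by positivity
    rw [Real.norm_eq_abs, abs_le]
    constructor <;> linarith
  have e : ∀ w, g w * quadKernel v w = g w * (‖(inner ℂ v w : ℂ)‖ ^ 2 - ‖v‖ ^ 2) -
      g w * (‖w‖ ^ 2 - n) := by
    intro w; rw [quadKernel]; ring
  simp_rw [e]
  rw [integral_sub i1 i2, Finset.sum_sub_distrib]
  congr 1
  · apply Complex.ofReal_injective
    rw [← quadratic_form_chaosMatrix hg v, ofReal_sum]
    simp_rw [norm_inner_symm _ v, norm_inner_sq_eq_sum, hb', Finset.mul_sum, Finset.sum_mul]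
    exact (Finset.sum_congr rfl fun i _ => Finset.sum_comm).trans Finset.sum_comm
  · apply Complex.ofReal_injective
    rw [← trace_chaosMatrix hg, ofReal_sum]
    simp_rw [norm_sq_eq_sum_complex, hb']
    rw [Finset.sum_comm]
    simp [mul_comm]

/-- This is `tr(A_f A_g) ≥ 0`: decomposing `A_g` leaves a sum of values of the quadratic form of
`A_f`. -/
lemma integral_integral_quadKernel_nonneg {f g : EuclideanSpace ℂ (Fin n) → ℝ}
    (hf : MemLp f 2 (complexGaussian n)) (hg : MemLp g 2 (complexGaussian n))
    (hf' : ∀ u, 0 ≤ ∫ w, f w * (‖(inner ℂ u w : ℂ)‖ ^ 2 - ‖u‖ ^ 2) ∂(complexGaussian n))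
    (hg' : ∀ u, 0 ≤ ∫ w, g w * (‖(inner ℂ u w : ℂ)‖ ^ 2 - ‖u‖ ^ 2) ∂(complexGaussian n)) :
    0 ≤ ∫ v, ∫ w, f v * g w * quadKernel v w ∂(complexGaussian n) ∂(complexGaussian n) := by
  obtain ⟨m, b, hb⟩ := exists_integral_quadKernel_eq hg hg'
  simp_rw [mul_assoc, integral_const_mul, hb, Finset.mul_sum]
  rw [integral_finsetSum]
  · exact Finset.sum_nonneg fun k _ => hf' _
  · intro k _
    refine integrable_mul_of_norm_le (F := ℝ) hf (by fun_prop) (‖b k‖ ^ 2) fun w => ?_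
    exact abs_norm_inner_sq_sub_le _ w
end form

/-! ### The correlation function and its infinitesimal sub-mean value property -/

section correlation
variable {n : ℕ} {f g : EuclideanSpace ℂ (Fin n) → ℝ}

/-- The correlation `E f(Z) g(W)` where `(Z, W)` is a Gaussian pair with `E W Z* = s`. -/
noncomputable def gaussianCorr (f g : EuclideanSpace ℂ (Fin n) → ℝ) (s : ℂ) : ℝ :=
  ∫ p, f p.1 * g p.2 ∂(gaussianPair n s)

lemma measurePreserving_fst_gaussianPair (s : ℂ) :
    MeasurePreserving Prod.fst (gaussianPair n s) (complexGaussian n) :=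
  ⟨measurable_fst, map_fst_gaussianPair s⟩

lemma measurePreserving_snd_gaussianPair {s : ℂ} (hs : ‖s‖ ≤ 1) :
    MeasurePreserving Prod.snd (gaussianPair n s) (complexGaussian n) :=
  ⟨measurable_snd, map_snd_gaussianPair hs⟩

lemma integrable_gaussianPair (hf : MemLp f 2 (complexGaussian n)) (hg : MemLp g 2 (complexGaussian n))
    {s : ℂ} (hs : ‖s‖ ≤ 1) : Integrable (fun p => f p.1 * g p.2) (gaussianPair n s) :=
  (hf.comp_measurePreserving (measurePreserving_fst_gaussianPair s)).integrable_mul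
    (hg.comp_measurePreserving (measurePreserving_snd_gaussianPair hs))

/-- The triple product of the standard Gaussian. -/
noncomputable abbrev gaussianTriple (n : ℕ) :
    Measure (EuclideanSpace ℂ (Fin n) × EuclideanSpace ℂ (Fin n) × EuclideanSpace ℂ (Fin n)) :=
  (complexGaussian n).prod ((complexGaussian n).prod (complexGaussian n))

/-- `√r u + √(1-r) v`. -/
noncomputable def mixVec (r : ℝ) (u v : EuclideanSpace ℂ (Fin n)) : EuclideanSpace ℂ (Fin n) :=
  (Real.sqrt r : ℂ) • u + (Real.sqrt (1 - r) : ℂ) • v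

lemma measurable_mixVec (r : ℝ) : Measurable fun p : EuclideanSpace ℂ (Fin n) ×
    EuclideanSpace ℂ (Fin n) => mixVec r p.1 p.2 := by
  unfold mixVec
  fun_prop

lemma measurable_mixPair (r : ℝ) : Measurable fun p : EuclideanSpace ℂ (Fin n) ×
    EuclideanSpace ℂ (Fin n) × EuclideanSpace ℂ (Fin n) =>
      (mixVec r p.1 p.2.1, mixVec r p.1 p.2.2) := by
  unfold mixVec
  fun_prop

lemma norm_convexCombination_le_one {r : ℝ} (hr0 : 0 ≤ r) (hr1 : r ≤ 1) {τ : ℂ} (hτ : ‖τ‖ ≤ 1) :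
    ‖(r + (1 - r) * τ : ℂ)‖ ≤ 1 := by
  refine (norm_add_le _ _).trans ?_
  have e : ((1 : ℂ) - r) = ((1 - r : ℝ) : ℂ) := by push_cast; ring
  rw [e, norm_mul, Complex.norm_real, Complex.norm_real, Real.norm_eq_abs, Real.norm_eq_abs,
    abs_of_nonneg hr0, abs_of_nonneg (by linarith)]
  nlinarith

/-- The shared component contributes `r` to the covariance and the pair contributes `(1-r)τ`;
expansions at `r` thereby become expansions at `τ = 0`. -/
lemma map_mixVec_prod_gaussianPair {r : ℝ} (hr0 : 0 ≤ r) (hr1 : r ≤ 1) {τ : ℂ} (hτ : ‖τ‖ ≤ 1) :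
    ((complexGaussian n).prod (gaussianPair n τ)).map
      (fun p => (mixVec r p.1 p.2.1, mixVec r p.1 p.2.2)) = gaussianPair n (r + (1 - r) * τ) := by
  have h0 : 0 ≤ 1 - ‖τ‖ ^ 2 := by nlinarith [norm_nonneg τ]
  have h1 : 0 ≤ 1 - r := by linarith
  set ρ : ℂ := (Real.sqrt (1 - ‖τ‖ ^ 2) : ℂ) with hρ
  have hρ2 : ‖ρ‖ ^ 2 = 1 - ‖τ‖ ^ 2 := norm_ofReal_sqrt_sq h0
  have hs : ‖(r + (1 - r) * τ : ℂ)‖ ≤ 1 := norm_convexCombination_le_one hr0 hr1 hτ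
  have hsq : ∀ x : ℝ, 0 ≤ x → (Real.sqrt x : ℂ) * (Real.sqrt x : ℂ) = x := by
    intro x hx
    rw [← ofReal_mul, Real.mul_self_sqrt hx]
  rw [← map_triple_eq_gaussianPair (n := n) (α₁ := Real.sqrt r) (α₂ := Real.sqrt (1 - r)) (α₃ := 0)
    (β₁ := Real.sqrt r) (β₂ := Real.sqrt (1 - r) * τ) (β₃ := Real.sqrt (1 - r) * ρ)
    (s := r + (1 - r) * τ) ?_ ?_ ?_ hs]
  · have e : (complexGaussian n).prod (gaussianPair n τ) = (gaussianTriple n).map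
        (Prod.map id fun p => (p.1, τ • p.1 + ρ • p.2)) := by
      rw [← Measure.map_prod_map _ _ measurable_id (measurable_gaussianPair_map _ _), Measure.map_id,
        gaussianPair]
    rw [e, Measure.map_map]
    · congr 1
      funext p
      simp only [mixVec, Function.comp_apply, Prod.map, id, smul_add, smul_smul, zero_smul, add_zero]
    · exact measurable_mixPair r
    · exact measurable_id.prodMap (measurable_gaussianPair_map _ _)
  · rw [norm_ofReal_sqrt_sq hr0, norm_ofReal_sqrt_sq h1]; simp
  · rw [norm_mul, norm_mul, mul_pow, mul_pow, norm_ofReal_sqrt_sq hr0, norm_ofReal_sqrt_sq h1, hρ2]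
    ring
  · simp only [conj_ofReal, map_zero, mul_zero, add_zero]
    rw [mul_right_comm, hsq r hr0, hsq _ h1]
    push_cast
    ring

lemma prod_gaussianPair_eq_withDensity {τ : ℂ} (hτ : ‖τ‖ < 1) :
    (complexGaussian n).prod (gaussianPair n τ) =
      (gaussianTriple n).withDensity fun p => ENNReal.ofReal (mehlerKernel n τ p.2) := by
  have hK : Measurable fun p => ENNReal.ofReal (mehlerKernel n τ p) :=
    (continuous_mehlerKernel τ).measurable.ennreal_ofReal
  rw [gaussianPair_eq_withDensity hτ, prod_withDensity_right hK]

/-- All dependence on `τ` moves into a density against one fixed measure, so different `τ` can be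
averaged under the integral sign. -/
lemma gaussianCorr_eq_integral_mehlerKernel (hfm : Measurable f) (hgm : Measurable g)
    (hf : MemLp f 2 (complexGaussian n)) (hg : MemLp g 2 (complexGaussian n))
    {r : ℝ} (hr0 : 0 ≤ r) (hr1 : r ≤ 1) {τ : ℂ} (hτ : ‖τ‖ < 1) :
    Integrable (fun p => mehlerKernel n τ p.2 * (f (mixVec r p.1 p.2.1) * g (mixVec r p.1 p.2.2)))
      (gaussianTriple n) ∧
    gaussianCorr f g (r + (1 - r) * τ) = ∫ p, mehlerKernel n τ p.2 *
      (f (mixVec r p.1 p.2.1) * g (mixVec r p.1 p.2.2)) ∂(gaussianTriple n) := by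
  have hs : ‖(r + (1 - r) * τ : ℂ)‖ ≤ 1 := norm_convexCombination_le_one hr0 hr1 hτ.le
  have hK : Measurable fun p : EuclideanSpace ℂ (Fin n) × EuclideanSpace ℂ (Fin n) ×
      EuclideanSpace ℂ (Fin n) => ENNReal.ofReal (mehlerKernel n τ p.2) :=
    ((continuous_mehlerKernel τ).measurable.comp measurable_snd).ennreal_ofReal
  have hfg : Measurable fun p : EuclideanSpace ℂ (Fin n) × EuclideanSpace ℂ (Fin n) =>
    f p.1 * g p.2 := (hfm.comp measurable_fst).mul (hgm.comp measurable_snd)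
  have hto : ∀ p : EuclideanSpace ℂ (Fin n) × EuclideanSpace ℂ (Fin n) × EuclideanSpace ℂ (Fin n),
      (ENNReal.ofReal (mehlerKernel n τ p.2)).toReal = mehlerKernel n τ p.2 := fun p =>
    ENNReal.toReal_ofReal (mehlerKernel_nonneg hτ _)
  constructor
  · have := integrable_gaussianPair hf hg hs
    rw [← map_mixVec_prod_gaussianPair hr0 hr1 hτ.le,
      integrable_map_measure hfg.aestronglyMeasurable (measurable_mixPair r).aemeasurable,
      prod_gaussianPair_eq_withDensity hτ,
      integrable_withDensity_iff_integrable_smul' hK (by simp)] at this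
    simpa only [hto, Function.comp_def, smul_eq_mul] using this
  · rw [gaussianCorr, ← map_mixVec_prod_gaussianPair hr0 hr1 hτ.le,
      integral_map (measurable_mixPair r).aemeasurable hfg.aestronglyMeasurable,
      prod_gaussianPair_eq_withDensity hτ,
      integral_withDensity_eq_integral_toReal_smul hK (by simp)]
    simp only [hto, smul_eq_mul]

lemma measurePreserving_mixVec_left {r : ℝ} (hr0 : 0 ≤ r) (hr1 : r ≤ 1) :
    MeasurePreserving (fun p => (mixVec r p.1 p.2.1, p.2.2)) (gaussianTriple n)
      ((complexGaussian n).prod (complexGaussian n)) := by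
  have h1 : 0 ≤ 1 - r := by linarith
  refine ⟨((measurable_mixVec r).comp (measurable_fst.prodMk measurable_snd.fst)).prodMk
    measurable_snd.snd, ?_⟩
  rw [← gaussianPair_zero, ← map_triple_eq_gaussianPair (n := n) (α₁ := Real.sqrt r)
    (α₂ := Real.sqrt (1 - r)) (α₃ := 0) (β₁ := 0) (β₂ := 0) (β₃ := 1)
    (by rw [norm_ofReal_sqrt_sq hr0, norm_ofReal_sqrt_sq h1]; simp) (by simp) (by simp) (by simp)]
  congr 1
  funext p
  simp [mixVec]

lemma measurePreserving_mixVec_right {r : ℝ} (hr0 : 0 ≤ r) (hr1 : r ≤ 1) :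
    MeasurePreserving (fun p => (mixVec r p.1 p.2.2, p.2.1)) (gaussianTriple n)
      ((complexGaussian n).prod (complexGaussian n)) := by
  have h1 : 0 ≤ 1 - r := by linarith
  refine ⟨((measurable_mixVec r).comp (measurable_fst.prodMk measurable_snd.snd)).prodMk
    measurable_snd.fst, ?_⟩
  rw [← gaussianPair_zero, ← map_triple_eq_gaussianPair (n := n) (α₁ := Real.sqrt r)
    (α₂ := 0) (α₃ := Real.sqrt (1 - r)) (β₁ := 0) (β₂ := 1) (β₃ := 0)
    (by rw [norm_ofReal_sqrt_sq hr0, norm_ofReal_sqrt_sq h1]; simp) (by simp) (by simp) (by simp)]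
  congr 1
  funext p
  simp [mixVec]

lemma memLp_mul_prod {b : EuclideanSpace ℂ (Fin n) → ℝ} (hf : MemLp f 2 (complexGaussian n))
    (hb : MemLp b 2 (complexGaussian n)) :
    MemLp (fun p : EuclideanSpace ℂ (Fin n) × EuclideanSpace ℂ (Fin n) => f p.1 * b p.2) 2
      ((complexGaussian n).prod (complexGaussian n)) := by
  refine (memLp_two_iff_integrable_sq (hf.1.comp_fst.mul hb.1.comp_snd)).2 ?_
  refine (hf.integrable_sq.mul_prod hb.integrable_sq).congr (ae_of_all _ fun p => ?_)
  simp only [Pi.mul_apply]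
  ring

/-- The weights are crossed: `f` sees only `U, V` and is paired with the weight in `V'`, of which it
is independent, while `g` takes the weight in `V`. Both products are then in `L²`. -/
lemma integrable_mixVec_mul_exp (hf : MemLp f 2 (complexGaussian n))
    (hg : MemLp g 2 (complexGaussian n)) {r : ℝ} (hr0 : 0 ≤ r) (hr1 : r ≤ 1) :
    Integrable (fun p => Real.exp ((‖p.2.1‖ ^ 2 + ‖p.2.2‖ ^ 2) / 4) *
      (f (mixVec r p.1 p.2.1) * g (mixVec r p.1 p.2.2))) (gaussianTriple n) := by
  have h1 := (memLp_mul_prod hf memLp_exp_norm_sq).comp_measurePreserving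
    (measurePreserving_mixVec_left hr0 hr1)
  have h2 := (memLp_mul_prod hg memLp_exp_norm_sq).comp_measurePreserving
    (measurePreserving_mixVec_right hr0 hr1)
  refine (h1.integrable_mul h2).congr (ae_of_all _ fun p => ?_)
  simp only [Function.comp_apply, Pi.mul_apply]
  rw [add_div, Real.exp_add]
  ring

lemma abs_quadKernel_le (v w : EuclideanSpace ℂ (Fin n)) :
    |quadKernel v w| ≤ (n + 16) * Real.exp ((‖v‖ ^ 2 + ‖w‖ ^ 2) / 4) := by
  have h1 : ‖(inner ℂ v w : ℂ)‖ ^ 2 ≤ (‖v‖ * ‖w‖) ^ 2 := by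
    gcongr; exact norm_inner_le_norm v w
  have h0 : 0 ≤ ‖(inner ℂ v w : ℂ)‖ ^ 2 := by positivity
  set N := ‖v‖ ^ 2 + ‖w‖ ^ 2 with hN
  have hN0 : 0 ≤ N := by positivity
  have h2 : (‖v‖ * ‖w‖) ^ 2 ≤ N ^ 2 / 4 := by
    rw [hN]; nlinarith [sq_nonneg (‖v‖ ^ 2 - ‖w‖ ^ 2)]
  have h3 := Real.quadratic_le_exp_of_nonneg (by positivity : 0 ≤ N / 4)
  have h4 : (1 : ℝ) ≤ Real.exp (N / 4) := Real.one_le_exp (by positivity)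
  have h5 : (n : ℝ) * 1 ≤ n * Real.exp (N / 4) := by gcongr
  have hn : (0 : ℝ) ≤ n := by positivity
  have h6 : quadKernel v w = ‖(inner ℂ v w : ℂ)‖ ^ 2 - N + n := by rw [quadKernel, hN]; ring
  rw [h6, abs_le]
  constructor <;> nlinarith

lemma continuous_quadKernel : Continuous fun p : EuclideanSpace ℂ (Fin n) × EuclideanSpace ℂ (Fin n) =>
    quadKernel p.1 p.2 := by
  unfold quadKernel
  fun_prop

lemma integrable_quadKernel_mul (hf : MemLp f 2 (complexGaussian n))
    (hg : MemLp g 2 (complexGaussian n)) (hfm : Measurable f) (hgm : Measurable g)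
    {r : ℝ} (hr0 : 0 ≤ r) (hr1 : r ≤ 1) :
    Integrable (fun p => quadKernel p.2.1 p.2.2 *
      (f (mixVec r p.1 p.2.1) * g (mixVec r p.1 p.2.2))) (gaussianTriple n) := by
  have hfg : Measurable fun p : EuclideanSpace ℂ (Fin n) × EuclideanSpace ℂ (Fin n) =>
    f p.1 * g p.2 := (hfm.comp measurable_fst).mul (hgm.comp measurable_snd)
  refine ((integrable_mixVec_mul_exp hf hg hr0 hr1).const_mul (n + 16)).mono
    (((continuous_quadKernel.measurable.comp measurable_snd).mul
      (hfg.comp (measurable_mixPair r))).aestronglyMeasurable) (ae_of_all _ fun p => ?_)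
  rw [norm_mul, ← mul_assoc, norm_mul (_ * _)]
  gcongr
  rw [Real.norm_eq_abs, Real.norm_eq_abs]
  exact (abs_quadKernel_le _ _).trans (le_abs_self _)

/-- Nonnegativity of the second-order coefficient in the expansion of the correlation. -/
lemma integral_quadKernel_mul_nonneg (hf : MemLp f 2 (complexGaussian n))
    (hg : MemLp g 2 (complexGaussian n)) (hfm : Measurable f) (hgm : Measurable g)
    {r : ℝ} (hr0 : 0 ≤ r) (hr1 : r ≤ 1)
    (hf' : ∀ᵐ u ∂(complexGaussian n), MemLp (fun v => f (mixVec r u v)) 2 (complexGaussian n) ∧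
      ∀ x, 0 ≤ ∫ v, f (mixVec r u v) * (‖(inner ℂ x v : ℂ)‖ ^ 2 - ‖x‖ ^ 2) ∂(complexGaussian n))
    (hg' : ∀ᵐ u ∂(complexGaussian n), MemLp (fun v => g (mixVec r u v)) 2 (complexGaussian n) ∧
      ∀ x, 0 ≤ ∫ v, g (mixVec r u v) * (‖(inner ℂ x v : ℂ)‖ ^ 2 - ‖x‖ ^ 2) ∂(complexGaussian n)) :
    0 ≤ ∫ p, quadKernel p.2.1 p.2.2 *
      (f (mixVec r p.1 p.2.1) * g (mixVec r p.1 p.2.2)) ∂(gaussianTriple n) := by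
  have hi := integrable_quadKernel_mul hf hg hfm hgm hr0 hr1
  rw [gaussianTriple, integral_prod _ hi]
  refine integral_nonneg_of_ae ?_
  filter_upwards [hf', hg', hi.prod_right_ae] with u hu1 hu2 hu3
  rw [integral_prod _ hu3]
  refine (integral_integral_quadKernel_nonneg hu1.1 hu2.1 hu1.2 hu2.2).trans_eq ?_
  refine integral_congr_ae (ae_of_all _ fun v => integral_congr_ae (ae_of_all _ fun w => ?_))
  simp only
  ring

/-- At `τ = ±t, ±it` the exponent of the kernel involves `±t Re ⟪v, w⟫` and `±t Im ⟪v, w⟫`, which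
reduces the claim to the scalar estimate. -/
lemma exists_abs_mehlerKernel_four_avg_le (n : ℕ) : ∃ C : ℝ, 0 ≤ C ∧ ∀ t : ℝ, 0 < t → t ≤ 1 / 32 →
    ∀ p : EuclideanSpace ℂ (Fin n) × EuclideanSpace ℂ (Fin n),
      |(mehlerKernel n t p + mehlerKernel n (-t) p + mehlerKernel n (I * t) p +
        mehlerKernel n (-(I * t)) p) / 4 - (1 + t ^ 2 * quadKernel p.1 p.2)| ≤
      C * t ^ 3 * Real.exp ((‖p.1‖ ^ 2 + ‖p.2‖ ^ 2) / 4) := by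
  obtain ⟨C, hC, h⟩ := exists_abs_exp_four_avg_mehler_le n
  refine ⟨C, hC, fun t ht ht1 p => ?_⟩
  set c : ℂ := inner ℂ p.1 p.2 with hc
  have hsq : c.re ^ 2 + c.im ^ 2 = ‖c‖ ^ 2 := by
    rw [Complex.sq_norm, Complex.normSq_apply]; ring
  have hle : c.re ^ 2 + c.im ^ 2 ≤ ((‖p.1‖ ^ 2 + ‖p.2‖ ^ 2) / 2) ^ 2 := by
    rw [hsq]
    have h1 : ‖c‖ ≤ ‖p.1‖ * ‖p.2‖ := norm_inner_le_norm _ _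
    have h2 : ‖p.1‖ * ‖p.2‖ ≤ (‖p.1‖ ^ 2 + ‖p.2‖ ^ 2) / 2 := by
      nlinarith [sq_nonneg (‖p.1‖ - ‖p.2‖)]
    gcongr
    exact h1.trans h2
  have := h t (‖p.1‖ ^ 2 + ‖p.2‖ ^ 2) c.re c.im ht ht1 (by positivity) hle
  have n1 : ‖(t : ℂ)‖ = t := by rw [Complex.norm_real, Real.norm_eq_abs, abs_of_pos ht]
  have k1 : (conj (t : ℂ) * c).re = t * c.re := by simp
  have k2 : (conj (-t : ℂ) * c).re = -(t * c.re) := by simp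
  have k3 : (conj (I * t : ℂ) * c).re = t * c.im := by simp
  have k4 : (conj (-(I * t) : ℂ) * c).re = -(t * c.im) := by simp
  have hq : quadKernel p.1 p.2 = c.re ^ 2 + c.im ^ 2 - (‖p.1‖ ^ 2 + ‖p.2‖ ^ 2) + n := by
    rw [hsq, quadKernel]; ring
  simp only [mehlerKernel, ← hc, k1, k2, k3, k4, norm_neg, norm_mul, norm_I, one_mul, n1, hq,
    ← mul_add, mul_div_assoc]
  simpa only [mul_div_assoc] using this

/-- Infinitesimal sub-mean value property of the correlation. -/
lemma exists_gaussianCorr_four_avg_ge (hf : MemLp f 2 (complexGaussian n))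
    (hg : MemLp g 2 (complexGaussian n)) (hfm : Measurable f) (hgm : Measurable g)
    {r : ℝ} (hr0 : 0 ≤ r) (hr1 : r ≤ 1)
    (hf' : ∀ᵐ u ∂(complexGaussian n), MemLp (fun v => f (mixVec r u v)) 2 (complexGaussian n) ∧
      ∀ x, 0 ≤ ∫ v, f (mixVec r u v) * (‖(inner ℂ x v : ℂ)‖ ^ 2 - ‖x‖ ^ 2) ∂(complexGaussian n))
    (hg' : ∀ᵐ u ∂(complexGaussian n), MemLp (fun v => g (mixVec r u v)) 2 (complexGaussian n) ∧
      ∀ x, 0 ≤ ∫ v, g (mixVec r u v) * (‖(inner ℂ x v : ℂ)‖ ^ 2 - ‖x‖ ^ 2) ∂(complexGaussian n)) :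
    ∃ C : ℝ, 0 ≤ C ∧ ∀ t : ℝ, 0 < t → t ≤ 1 / 32 → gaussianCorr f g r - C * t ^ 3 ≤
      (gaussianCorr f g (r + (1 - r) * t) + gaussianCorr f g (r + (1 - r) * (-t)) +
        gaussianCorr f g (r + (1 - r) * (I * t)) + gaussianCorr f g (r + (1 - r) * (-(I * t)))) / 4 := by
  obtain ⟨C, hC, hK⟩ := exists_abs_mehlerKernel_four_avg_le n
  have hb := (integrable_mixVec_mul_exp hf hg hr0 hr1).norm
  set M := ∫ p, ‖Real.exp ((‖p.2.1‖ ^ 2 + ‖p.2.2‖ ^ 2) / 4) *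
      (f (mixVec r p.1 p.2.1) * g (mixVec r p.1 p.2.2))‖ ∂(gaussianTriple n) with hM
  have hM0 : 0 ≤ M := integral_nonneg fun _ => norm_nonneg _
  refine ⟨C * M, by positivity, fun t ht ht1 => ?_⟩
  have n1 : ‖(t : ℂ)‖ < 1 := by
    rw [Complex.norm_real, Real.norm_eq_abs, abs_of_pos ht]; linarith
  have n2 : ‖(-t : ℂ)‖ < 1 := by rwa [norm_neg]
  have n3 : ‖(I * t : ℂ)‖ < 1 := by rwa [norm_mul, norm_I, one_mul]
  have n4 : ‖(-(I * t) : ℂ)‖ < 1 := by rwa [norm_neg]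
  obtain ⟨i0, e0⟩ := gaussianCorr_eq_integral_mehlerKernel hfm hgm hf hg hr0 hr1 (τ := 0) (by simp)
  obtain ⟨i1, e1⟩ := gaussianCorr_eq_integral_mehlerKernel hfm hgm hf hg hr0 hr1 n1
  obtain ⟨i2, e2⟩ := gaussianCorr_eq_integral_mehlerKernel hfm hgm hf hg hr0 hr1 n2
  obtain ⟨i3, e3⟩ := gaussianCorr_eq_integral_mehlerKernel hfm hgm hf hg hr0 hr1 n3
  obtain ⟨i4, e4⟩ := gaussianCorr_eq_integral_mehlerKernel hfm hgm hf hg hr0 hr1 n4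
  have iq := integrable_quadKernel_mul hf hg hfm hgm hr0 hr1
  have hq := integral_quadKernel_mul_nonneg hf hg hfm hgm hr0 hr1 hf' hg'
  have k0 : ∀ p : EuclideanSpace ℂ (Fin n) × EuclideanSpace ℂ (Fin n), mehlerKernel n 0 p = 1 := by
    intro p; simp [mehlerKernel]
  simp only [k0, one_mul] at i0 e0
  rw [mul_zero, add_zero] at e0
  rw [e0, e1, e2, e3, e4, ← integral_four_avg i1 i2 i3 i4]
  have hlow : ∫ p, (f (mixVec r p.1 p.2.1) * g (mixVec r p.1 p.2.2) +
      t ^ 2 * (quadKernel p.2.1 p.2.2 * (f (mixVec r p.1 p.2.1) * g (mixVec r p.1 p.2.2))) -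
      C * t ^ 3 * ‖Real.exp ((‖p.2.1‖ ^ 2 + ‖p.2.2‖ ^ 2) / 4) *
      (f (mixVec r p.1 p.2.1) * g (mixVec r p.1 p.2.2))‖) ∂(gaussianTriple n) ≤
      ∫ p, (mehlerKernel n t p.2 * (f (mixVec r p.1 p.2.1) * g (mixVec r p.1 p.2.2)) +
        mehlerKernel n (-t) p.2 * (f (mixVec r p.1 p.2.1) * g (mixVec r p.1 p.2.2)) +
        mehlerKernel n (I * t) p.2 * (f (mixVec r p.1 p.2.1) * g (mixVec r p.1 p.2.2)) +
        mehlerKernel n (-(I * t)) p.2 * (f (mixVec r p.1 p.2.1) * g (mixVec r p.1 p.2.2))) / 4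
        ∂(gaussianTriple n) := by
    refine integral_mono ((i0.add (iq.const_mul _)).sub (hb.const_mul _))
      (integrable_four_avg i1 i2 i3 i4) fun p => ?_
    simp only
    set X := f (mixVec r p.1 p.2.1) * g (mixVec r p.1 p.2.2)
    have h1 := hK t ht ht1 p.2
    set K := (mehlerKernel n t p.2 + mehlerKernel n (-t) p.2 + mehlerKernel n (I * t) p.2 +
        mehlerKernel n (-(I * t)) p.2) / 4 with hKdef
    have h2 : -((K - (1 + t ^ 2 * quadKernel p.2.1 p.2.2)) * X) ≤
        C * t ^ 3 * ‖Real.exp ((‖p.2.1‖ ^ 2 + ‖p.2.2‖ ^ 2) / 4) * X‖ := by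
      refine (neg_le_abs _).trans ?_
      rw [abs_mul, norm_mul, Real.norm_eq_abs, Real.abs_exp, Real.norm_eq_abs, ← mul_assoc]
      gcongr
    calc _ ≤ K * X := by linarith
      _ = _ := by rw [hKdef]; ring
  refine le_trans ?_ hlow
  have iR : Integrable (fun p => f (mixVec r p.1 p.2.1) * g (mixVec r p.1 p.2.2) +
      t ^ 2 * (quadKernel p.2.1 p.2.2 * (f (mixVec r p.1 p.2.1) * g (mixVec r p.1 p.2.2))))
      (gaussianTriple n) := i0.add (iq.const_mul _)
  rw [integral_sub iR (hb.const_mul _), integral_add i0 (iq.const_mul _), integral_const_mul,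
    integral_const_mul, ← hM]
  have : 0 ≤ t ^ 2 * ∫ p, quadKernel p.2.1 p.2.2 *
      (f (mixVec r p.1 p.2.1) * g (mixVec r p.1 p.2.2)) ∂(gaussianTriple n) := by positivity
  linarith

end correlation

/-! ### Radial symmetry and the values at `0` and `1` -/

section radial
variable {n : ℕ} {f g : EuclideanSpace ℂ (Fin n) → ℝ}

/-- The first vector enters the covariance `E W Z*` conjugated, hence `conj c`. -/
lemma map_smul_gaussianPair {c s : ℂ} (hc : ‖c‖ = 1) (hs : ‖s‖ ≤ 1) :
    (gaussianPair n s).map (fun p => (conj c • p.1, p.2)) = gaussianPair n (c * s) := by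
  have h0 : 0 ≤ 1 - ‖s‖ ^ 2 := by nlinarith [norm_nonneg s]
  set ρ : ℂ := (Real.sqrt (1 - ‖s‖ ^ 2) : ℂ) with hρ
  have hρ2 : ‖ρ‖ ^ 2 = 1 - ‖s‖ ^ 2 := norm_ofReal_sqrt_sq h0
  have h1 := map_triple_eq_gaussianPair (n := n) (α₁ := 1) (α₂ := 0) (α₃ := 0) (β₁ := s) (β₂ := ρ)
    (β₃ := 0) (s := s) (by simp) (by rw [hρ2]; simp) (by simp) hs
  have h2 := map_triple_eq_gaussianPair (n := n) (α₁ := conj c) (α₂ := 0) (α₃ := 0) (β₁ := s)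
    (β₂ := ρ) (β₃ := 0) (s := c * s) (by simp [hc]) (by rw [hρ2]; simp) (by simp [mul_comm])
    (by rwa [norm_mul, hc, one_mul])
  rw [← h1, ← h2, Measure.map_map (by fun_prop) (by fun_prop)]
  congr 1
  funext p
  simp only [Function.comp_apply, one_smul, zero_smul, add_zero]

lemma gaussianCorr_mul_left (hfm : Measurable f) (hgm : Measurable g)
    (hsymm : ∀ c : ℂ, ‖c‖ = 1 → ∀ w, f (c • w) = f w) {c s : ℂ} (hc : ‖c‖ = 1) (hs : ‖s‖ ≤ 1) :
    gaussianCorr f g (c * s) = gaussianCorr f g s := by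
  have hfg : Measurable fun p : EuclideanSpace ℂ (Fin n) × EuclideanSpace ℂ (Fin n) =>
    f p.1 * g p.2 := (hfm.comp measurable_fst).mul (hgm.comp measurable_snd)
  rw [gaussianCorr, ← map_smul_gaussianPair hc hs, integral_map (by fun_prop) hfg.aestronglyMeasurable,
    gaussianCorr]
  simp_rw [hsymm (conj c) (by rwa [RCLike.norm_conj])]

lemma gaussianCorr_eq_norm (hfm : Measurable f) (hgm : Measurable g)
    (hsymm : ∀ c : ℂ, ‖c‖ = 1 → ∀ w, f (c • w) = f w) {s : ℂ} (hs : ‖s‖ ≤ 1) :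
    gaussianCorr f g s = gaussianCorr f g ‖s‖ := by
  have h : cexp (arg s * I) * (‖s‖ : ℂ) = s := by
    rw [mul_comm]; exact Complex.norm_mul_exp_arg_mul_I s
  conv_lhs => rw [← h]
  exact gaussianCorr_mul_left hfm hgm hsymm (Complex.norm_exp_ofReal_mul_I _) (by simpa using hs)

lemma gaussianCorr_zero (f g : EuclideanSpace ℂ (Fin n) → ℝ) : gaussianCorr f g 0 =
    (∫ z, f z ∂(complexGaussian n)) * ∫ z, g z ∂(complexGaussian n) := by
  rw [gaussianCorr, gaussianPair_zero, integral_prod_mul]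

lemma gaussianCorr_one (hfm : Measurable f) (hgm : Measurable g) : gaussianCorr f g 1 =
    ∫ z, f z * g z ∂(complexGaussian n) := by
  have hfg : Measurable fun p : EuclideanSpace ℂ (Fin n) × EuclideanSpace ℂ (Fin n) =>
    f p.1 * g p.2 := (hfm.comp measurable_fst).mul (hgm.comp measurable_snd)
  have e : ∫ z, f z * g z ∂(complexGaussian n) =
      ∫ p, f p.1 * g p.1 ∂((complexGaussian n).prod (complexGaussian n)) := by
    rw [integral_fun_fst (fun z => f z * g z)]
    simp
  rw [gaussianCorr, gaussianPair, integral_map (measurable_gaussianPair_map _ _).aemeasurable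
    hfg.aestronglyMeasurable, e]
  simp

end radial

/-! ### Continuity of the correlation on the closed disc -/

section continuity
variable {n : ℕ} {f g : EuclideanSpace ℂ (Fin n) → ℝ}

/-- Both marginals are standard for every `s`, so Cauchy–Schwarz is uniform in `s`. Hence `L²`
approximation of `f` and `g` by bounded continuous functions is uniform approximation of the
correlation. -/
lemma abs_gaussianCorr_le (hf : MemLp f 2 (complexGaussian n)) (hg : MemLp g 2 (complexGaussian n))
    {s : ℂ} (hs : ‖s‖ ≤ 1) : |gaussianCorr f g s| ≤
      (eLpNorm f 2 (complexGaussian n)).toReal * (eLpNorm g 2 (complexGaussian n)).toReal := by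
  have hf' := hf.comp_measurePreserving (measurePreserving_fst_gaussianPair s)
  have hg' := hg.comp_measurePreserving (measurePreserving_snd_gaussianPair hs)
  have h1 : ‖gaussianCorr f g s‖ₑ ≤
      eLpNorm f 2 (complexGaussian n) * eLpNorm g 2 (complexGaussian n) := by
    rw [← eLpNorm_comp_measurePreserving hf.1 (measurePreserving_fst_gaussianPair s),
      ← eLpNorm_comp_measurePreserving hg.1 (measurePreserving_snd_gaussianPair hs)]
    refine (enorm_integral_le_lintegral_enorm _).trans ?_
    have h : eLpNorm ((f ∘ Prod.fst) • (g ∘ Prod.snd)) 1 (gaussianPair n s) ≤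
        eLpNorm (f ∘ Prod.fst) 2 (gaussianPair n s) * eLpNorm (g ∘ Prod.snd) 2 (gaussianPair n s) :=
      eLpNorm_smul_le_mul_eLpNorm hg'.1 hf'.1
    rw [eLpNorm_one_eq_lintegral_enorm] at h
    exact h
  rw [← ENNReal.toReal_mul, ← Real.norm_eq_abs, ← toReal_enorm]
  exact ENNReal.toReal_mono (ENNReal.mul_ne_top hf.2.ne hg.2.ne) h1

lemma continuous_gaussianCorr_boundedContinuous
    (f g : BoundedContinuousFunction (EuclideanSpace ℂ (Fin n)) ℝ) :
    Continuous fun s => gaussianCorr f g s := by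
  have e : ∀ s, gaussianCorr f g s =
      ∫ p, f p.1 * g (s • p.1 + (Real.sqrt (1 - ‖s‖ ^ 2) : ℂ) • p.2)
        ∂((complexGaussian n).prod (complexGaussian n)) := by
    intro s
    rw [gaussianCorr, gaussianPair, integral_map (measurable_gaussianPair_map _ _).aemeasurable]
    exact (by fun_prop : Continuous fun p : EuclideanSpace ℂ (Fin n) × EuclideanSpace ℂ (Fin n) =>
      f p.1 * g p.2).aestronglyMeasurable
  simp_rw [e]
  refine continuous_of_dominated (bound := fun _ => ‖f‖ * ‖g‖) (fun s => ?_)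
    (fun s => ae_of_all _ fun p => ?_) (integrable_const _) (ae_of_all _ fun p => ?_)
  · exact (by fun_prop : Continuous fun p : EuclideanSpace ℂ (Fin n) × EuclideanSpace ℂ (Fin n) =>
      f p.1 * g (s • p.1 + (Real.sqrt (1 - ‖s‖ ^ 2) : ℂ) • p.2)).aestronglyMeasurable
  · rw [norm_mul]
    exact mul_le_mul (f.norm_coe_le_norm _) (g.norm_coe_le_norm _) (norm_nonneg _) (norm_nonneg _)
  · fun_prop

lemma exists_boundedContinuous_toReal_eLpNorm_mul_lt (hf : MemLp f 2 (complexGaussian n)) {N ε : ℝ}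
    (hN : 0 ≤ N) (hε : 0 < ε) : ∃ f₀ : BoundedContinuousFunction (EuclideanSpace ℂ (Fin n)) ℝ,
      MemLp f₀ 2 (complexGaussian n) ∧
      (eLpNorm (f - ⇑f₀) 2 (complexGaussian n)).toReal * N < ε := by
  obtain ⟨f₀, h1, h2⟩ := hf.exists_boundedContinuous_eLpNorm_sub_le (by norm_num)
    (ε := ENNReal.ofReal (ε / (N + 1))) (by simp; positivity)
  refine ⟨f₀, h2, ?_⟩
  have h3 : (eLpNorm (f - ⇑f₀) 2 (complexGaussian n)).toReal ≤ ε / (N + 1) :=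
    ENNReal.toReal_le_of_le_ofReal (by positivity) h1
  calc _ ≤ ε / (N + 1) * N := by gcongr
    _ < ε / (N + 1) * (N + 1) := by gcongr; linarith
    _ = ε := by field_simp

lemma continuousOn_of_forall_abs_sub_lt {X : Type*} [TopologicalSpace X] {F : X → ℝ} {S : Set X}
    (h : ∀ ε : ℝ, 0 < ε → ∃ G : X → ℝ, ContinuousOn G S ∧ ∀ x ∈ S, |F x - G x| < ε) :
    ContinuousOn F S := by
  refine continuousOn_of_uniform_approx_of_continuousOn fun u hu => ?_
  obtain ⟨ε, hε, hu⟩ := Metric.mem_uniformity_dist.1 hu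
  obtain ⟨G, hG, hFG⟩ := h ε hε
  exact ⟨G, hG, fun x hx => hu (hFG x hx)⟩

lemma gaussianCorr_sub_right {g₀ : EuclideanSpace ℂ (Fin n) → ℝ} (hf : MemLp f 2 (complexGaussian n))
    (hg : MemLp g 2 (complexGaussian n)) (hg₀ : MemLp g₀ 2 (complexGaussian n)) {s : ℂ}
    (hs : ‖s‖ ≤ 1) : gaussianCorr f g s - gaussianCorr f g₀ s = gaussianCorr f (g - g₀) s := by
  simp only [gaussianCorr, Pi.sub_apply, mul_sub]
  rw [integral_sub (integrable_gaussianPair hf hg hs) (integrable_gaussianPair hf hg₀ hs)]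

lemma gaussianCorr_sub_left {f₀ : EuclideanSpace ℂ (Fin n) → ℝ} (hf : MemLp f 2 (complexGaussian n))
    (hg : MemLp g 2 (complexGaussian n)) (hf₀ : MemLp f₀ 2 (complexGaussian n)) {s : ℂ}
    (hs : ‖s‖ ≤ 1) : gaussianCorr f g s - gaussianCorr f₀ g s = gaussianCorr (f - f₀) g s := by
  simp only [gaussianCorr, Pi.sub_apply, sub_mul]
  rw [integral_sub (integrable_gaussianPair hf hg hs) (integrable_gaussianPair hf₀ hg hs)]

lemma continuousOn_gaussianCorr_boundedContinuous
    (f : BoundedContinuousFunction (EuclideanSpace ℂ (Fin n)) ℝ)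
    (hf : MemLp f 2 (complexGaussian n)) (hg : MemLp g 2 (complexGaussian n)) :
    ContinuousOn (gaussianCorr f g) (Metric.closedBall 0 1) := by
  refine continuousOn_of_forall_abs_sub_lt fun ε hε => ?_
  obtain ⟨g₀, h1, h2⟩ := exists_boundedContinuous_toReal_eLpNorm_mul_lt hg
    (N := (eLpNorm f 2 (complexGaussian n)).toReal) ENNReal.toReal_nonneg hε
  refine ⟨gaussianCorr f g₀, (continuous_gaussianCorr_boundedContinuous f g₀).continuousOn,
    fun s hs => ?_⟩
  have hs' : ‖s‖ ≤ 1 := by simpa using hs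
  rw [gaussianCorr_sub_right hf hg h1 hs']
  refine (abs_gaussianCorr_le hf (hg.sub h1) hs').trans_lt ?_
  rwa [mul_comm]

lemma continuousOn_gaussianCorr (hf : MemLp f 2 (complexGaussian n))
    (hg : MemLp g 2 (complexGaussian n)) :
    ContinuousOn (gaussianCorr f g) (Metric.closedBall 0 1) := by
  refine continuousOn_of_forall_abs_sub_lt fun ε hε => ?_
  obtain ⟨f₀, h1, h2⟩ := exists_boundedContinuous_toReal_eLpNorm_mul_lt hf
    (N := (eLpNorm g 2 (complexGaussian n)).toReal) ENNReal.toReal_nonneg hε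
  refine ⟨gaussianCorr f₀ g, continuousOn_gaussianCorr_boundedContinuous f₀ h1 hg, fun s hs => ?_⟩
  have hs' : ‖s‖ ≤ 1 := by simpa using hs
  rw [gaussianCorr_sub_left hf hg h1 hs']
  exact (abs_gaussianCorr_le (hf.sub h1) hg hs').trans_lt h2

end continuity

/-! ### A maximum principle for radial functions -/

section maxPrinciple

/-- Maximum principle: a radial continuous function on the closed disc with an infinitesimal
sub-mean value property is at most its boundary value at the centre. -/
lemma le_of_radial_four_avg {F : ℂ → ℝ} (hcont : ContinuousOn F (Metric.closedBall 0 1))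
    (hrad : ∀ s : ℂ, ‖s‖ ≤ 1 → F s = F ‖s‖)
    (hsub : ∀ r : ℝ, 0 ≤ r → r < 1 → ∃ C : ℝ, 0 ≤ C ∧ ∀ t : ℝ, 0 < t → t ≤ 1 / 32 →
      F r - C * t ^ 3 ≤ (F (r + (1 - r) * t) + F (r + (1 - r) * (-t)) +
        F (r + (1 - r) * (I * t)) + F (r + (1 - r) * (-(I * t)))) / 4) : F 0 ≤ F 1 := by
  refine le_of_forall_pos_le_add fun η hη => ?_
  -- The term `η‖s‖²` makes subharmonicity strict and costs only `η` at the boundary.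
  have hφ : ContinuousOn (fun s => F s + η * ‖s‖ ^ 2) (Metric.closedBall 0 1) :=
    hcont.add (by fun_prop)
  obtain ⟨s₀, hs₀, hmax⟩ := (isCompact_closedBall (0 : ℂ) 1).exists_isMaxOn
    ⟨0, by simp⟩ hφ
  have hs₀' : ‖s₀‖ ≤ 1 := by simpa using hs₀
  have hmax' : ∀ s : ℂ, ‖s‖ ≤ 1 → F s + η * ‖s‖ ^ 2 ≤ F ‖s₀‖ + η * ‖s₀‖ ^ 2 := by
    intro s hs
    rw [← hrad s₀ hs₀']
    exact hmax (by simpa using hs)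
  -- Radiality moves the maximum point to the nonnegative real axis, where `hsub` applies.
  set r := ‖s₀‖ with hr
  have hr0 : 0 ≤ r := norm_nonneg _
  rcases hs₀'.eq_or_lt with h1 | h1
  · have := hmax' 0 (by simp)
    rw [h1] at this
    simpa using this
  · exfalso
    obtain ⟨C, hC, hav⟩ := hsub r hr0 h1
    -- The four-point average of `‖s‖²` exceeds `r²` by `(1-r)²t²`, so maximality gives `η(1-r)² ≤
    -- Ct` for all small `t`.
    have key : 0 ≤ -(η * (1 - r) ^ 2) := by
      refine nonneg_of_forall_pos_small (ε₀ := 1 / 32) (by norm_num) hC fun t ht ht1 => ?_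
      have n1 : ‖(t : ℂ)‖ ≤ 1 := by
        rw [Complex.norm_real, Real.norm_eq_abs, abs_of_pos ht]; linarith
      have b1 := hmax' _ (norm_convexCombination_le_one hr0 h1.le n1)
      have b2 := hmax' _ (norm_convexCombination_le_one hr0 h1.le (τ := -t) (by rwa [norm_neg]))
      have b3 := hmax' _ (norm_convexCombination_le_one hr0 h1.le (τ := I * t)
        (by rwa [norm_mul, norm_I, one_mul]))
      have b4 := hmax' _ (norm_convexCombination_le_one hr0 h1.le (τ := -(I * t))
        (by rwa [norm_neg, norm_mul, norm_I, one_mul]))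
      have a := hav t ht ht1
      have m1 : ‖(r + (1 - r) * t : ℂ)‖ ^ 2 = (r + (1 - r) * t) ^ 2 := by
        rw [Complex.sq_norm, Complex.normSq_apply]; simp; ring
      have m2 : ‖(r + (1 - r) * (-t) : ℂ)‖ ^ 2 = (r - (1 - r) * t) ^ 2 := by
        rw [Complex.sq_norm, Complex.normSq_apply]; simp; ring
      have m3 : ‖(r + (1 - r) * (I * t) : ℂ)‖ ^ 2 = r ^ 2 + ((1 - r) * t) ^ 2 := by
        rw [Complex.sq_norm, Complex.normSq_apply]; simp; ring
      have m4 : ‖(r + (1 - r) * (-(I * t)) : ℂ)‖ ^ 2 = r ^ 2 + ((1 - r) * t) ^ 2 := by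
        rw [Complex.sq_norm, Complex.normSq_apply]; simp; ring
      rw [m1] at b1
      rw [m2] at b2
      rw [m3] at b3
      rw [m4] at b4
      have : 0 ≤ t ^ 2 * (-(η * (1 - r) ^ 2) + t * C) := by nlinarith
      exact nonneg_of_mul_nonneg_right this (by positivity)
    have : 0 < η * (1 - r) ^ 2 := by
      have : 0 < 1 - r := by linarith
      positivity
    linarith

end maxPrinciple

/-! ### From extended-real integrals to Bochner integrals -/

section extIntegral
variable {X : Type*} [MeasurableSpace X] {μ : Measure X}

lemma coe_lintegral_sub_eq_integral {φ : X → ℝ} (hi : Integrable φ μ) :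
    ((∫⁻ x, ENNReal.ofReal (φ x) ∂μ : ENNReal) : EReal) -
      ((∫⁻ x, ENNReal.ofReal (-φ x) ∂μ : ENNReal) : EReal) = ((∫ x, φ x ∂μ : ℝ) : EReal) := by
  have h1 : ∫⁻ x, ENNReal.ofReal (φ x) ∂μ ≠ ⊤ := hi.lintegral_lt_top.ne
  have h2 : ∫⁻ x, ENNReal.ofReal (-φ x) ∂μ ≠ ⊤ := hi.neg.lintegral_lt_top.ne
  rw [integral_eq_lintegral_pos_part_sub_lintegral_neg_part hi, EReal.coe_sub,
    EReal.coe_ennreal_toReal h1, EReal.coe_ennreal_toReal h2]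

/-- `toReal` replaces `-∞` by `0`, which can only raise the integral. No finiteness on the circle is
then required. -/
lemma extIntegral_le_integral_toReal {φ : X → EReal} (hlt : ∀ x, φ x < ⊤)
    (hi : Integrable (fun x => (φ x).toReal) μ) :
    extIntegral μ φ ≤ ((∫ x, (φ x).toReal ∂μ : ℝ) : EReal) := by
  rw [← coe_lintegral_sub_eq_integral hi, extIntegral]
  refine EReal.sub_le_sub ?_ ?_
  · refine EReal.coe_ennreal_le_coe_ennreal_iff.2 (lintegral_mono fun x => ?_)
    rw [EReal.toENNReal_of_ne_top (hlt x).ne]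
  · refine EReal.coe_ennreal_le_coe_ennreal_iff.2 (lintegral_mono fun x => ?_)
    simp only
    rcases eq_or_ne (φ x) ⊥ with h | h
    · simp [h]
    · rw [EReal.toENNReal_of_ne_top (by simpa [EReal.neg_eq_top_iff] using h), EReal.toReal_neg_eq]

lemma extIntegral_eq_integral_toReal {φ : X → EReal} (hfin : ∀ᵐ x ∂μ, φ x ≠ ⊤ ∧ φ x ≠ ⊥)
    (hi : Integrable (fun x => (φ x).toReal) μ) :
    extIntegral μ φ = ((∫ x, (φ x).toReal ∂μ : ℝ) : EReal) := by
  rw [← coe_lintegral_sub_eq_integral hi, extIntegral]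
  congr 2
  · refine lintegral_congr_ae ?_
    filter_upwards [hfin] with x hx
    rw [EReal.toENNReal_of_ne_top hx.1]
  · refine lintegral_congr_ae ?_
    filter_upwards [hfin] with x hx
    rw [EReal.toENNReal_of_ne_top (by simpa [EReal.neg_eq_top_iff] using hx.2), EReal.toReal_neg_eq]

lemma measurable_ereal_abs : Measurable EReal.abs :=
  EReal.measurable_of_measurable_real (by simp only [EReal.abs_def]; fun_prop)

lemma abs_eq_enorm_toReal {x : EReal} (h1 : x ≠ ⊤) (h2 : x ≠ ⊥) : x.abs = ‖x.toReal‖ₑ := by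
  lift x to ℝ using ⟨h1, h2⟩
  rw [EReal.toReal_coe, EReal.abs_def, Real.enorm_eq_ofReal_abs]

lemma ne_top_and_ne_bot_of_abs_lt_top {x : EReal} (h : x.abs < ⊤) : x ≠ ⊤ ∧ x ≠ ⊥ := by
  constructor <;> rintro rfl <;> simp at h

lemma lintegral_abs_lt_top {φ : X → EReal} (hfin : ∀ᵐ x ∂μ, φ x ≠ ⊤ ∧ φ x ≠ ⊥)
    (hi : Integrable (fun x => (φ x).toReal) μ) : ∫⁻ x, (φ x).abs ∂μ < ⊤ := by
  refine lt_of_eq_of_lt (lintegral_congr_ae ?_) hi.2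
  filter_upwards [hfin] with x hx
  exact abs_eq_enorm_toReal hx.1 hx.2

end extIntegral

/-! ### Plurisubharmonic functions as real-valued `L²` functions -/

section transfer
variable {n : ℕ} {f g : EuclideanSpace ℂ (Fin n) → EReal}

lemma IsPlurisubharmonic.measurable (hf : IsPlurisubharmonic f) : Measurable f :=
  hf.upperSemicontinuous.measurable

lemma IsGaussianSquareIntegrable.ae_finite (hf : IsPlurisubharmonic f)
    (hf2 : IsGaussianSquareIntegrable f) : ∀ᵐ z ∂(complexGaussian n), f z ≠ ⊤ ∧ f z ≠ ⊥ := by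
  have hm : Measurable fun z => (f z).abs ^ 2 := (measurable_ereal_abs.comp hf.measurable).pow_const 2
  filter_upwards [ae_lt_top hm hf2.ne] with z hz
  refine ne_top_and_ne_bot_of_abs_lt_top ?_
  by_contra h
  rw [not_lt, top_le_iff] at h
  simp [h] at hz

lemma IsGaussianSquareIntegrable.memLp (hf : IsPlurisubharmonic f)
    (hf2 : IsGaussianSquareIntegrable f) : MemLp (fun z => (f z).toReal) 2 (complexGaussian n) := by
  refine ⟨hf.measurable.ereal_toReal.aestronglyMeasurable, ?_⟩
  rw [eLpNorm_lt_top_iff_lintegral_rpow_enorm_lt_top (by norm_num) (by norm_num)]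
  refine lt_of_eq_of_lt (lintegral_congr_ae ?_) hf2
  filter_upwards [hf2.ae_finite hf] with z hz
  rw [abs_eq_enorm_toReal hz.1 hz.2]
  norm_num

lemma measurePreserving_mixVec {r : ℝ} (hr0 : 0 ≤ r) (hr1 : r ≤ 1) :
    MeasurePreserving (fun p : EuclideanSpace ℂ (Fin n) × EuclideanSpace ℂ (Fin n) =>
      mixVec r p.1 p.2) ((complexGaussian n).prod (complexGaussian n)) (complexGaussian n) := by
  have h := map_mixVec_prod_gaussianPair (n := n) hr0 hr1 (τ := 1) (by simp)
  refine ⟨measurable_mixVec r, ?_⟩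
  have h2 := map_fst_gaussianPair (n := n) (r + (1 - r) * 1)
  rw [← h, Measure.map_map measurable_fst (measurable_mixPair r)] at h2
  have e : (complexGaussian n).prod (complexGaussian n) =
      ((complexGaussian n).prod (gaussianPair n 1)).map (Prod.map id Prod.fst) := by
    rw [← Measure.map_prod_map _ _ measurable_id measurable_fst, Measure.map_id,
      map_fst_gaussianPair]
  rw [e, Measure.map_map (measurable_mixVec r) (measurable_id.prodMap measurable_fst)]
  exact h2

/-- The map `v ↦ √r u + √(1-r) v` is complex affine and carries circles to circles, possibly
degenerate, so the slices keep the sub-mean value property. Fubini gives square integrability and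
finiteness for almost every `u`. -/
lemma ae_mixVec_memLp_and_nonneg (hf : IsPlurisubharmonic f) (hf2 : IsGaussianSquareIntegrable f)
    {r : ℝ} (hr0 : 0 ≤ r) (hr1 : r ≤ 1) : ∀ᵐ u ∂(complexGaussian n),
      MemLp (fun v => (f (mixVec r u v)).toReal) 2 (complexGaussian n) ∧
      ∀ x, 0 ≤ ∫ v, (f (mixVec r u v)).toReal * (‖(inner ℂ x v : ℂ)‖ ^ 2 - ‖x‖ ^ 2)
        ∂(complexGaussian n) := by
  have hmp := measurePreserving_mixVec (n := n) hr0 hr1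
  have h1 := ((hf2.memLp hf).comp_measurePreserving hmp).integrable_sq.prod_right_ae
  have h2 : ∀ᵐ u ∂(complexGaussian n), ∀ᵐ v ∂(complexGaussian n),
      f (mixVec r u v) ≠ ⊤ ∧ f (mixVec r u v) ≠ ⊥ :=
    Measure.ae_ae_of_ae_prod (hmp.quasiMeasurePreserving.ae (hf2.ae_finite hf))
  filter_upwards [h1, h2] with u hu1 hu2
  have hm : Measurable fun v => (f (mixVec r u v)).toReal :=
    (hf.measurable.comp ((measurable_mixVec r).comp measurable_prodMk_left)).ereal_toReal
  have hL : MemLp (fun v => (f (mixVec r u v)).toReal) 2 (complexGaussian n) :=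
    (memLp_two_iff_integrable_sq hm.aestronglyMeasurable).2 hu1
  refine ⟨hL, integral_mul_norm_inner_sq_sub_nonneg hm hL fun x => ?_⟩
  filter_upwards [hu2] with v hv hi
  have e : ∀ θ : ℝ, mixVec r u (v + cexp (θ * I) • x) =
      mixVec r u v + cexp (θ * I) • ((Real.sqrt (1 - r) : ℂ) • x) := by
    intro θ
    simp only [mixVec, smul_add, add_assoc, smul_comm (cexp (θ * I))]
  simp only [e] at hi ⊢
  have := (hf.le_circle_average (mixVec r u v) ((Real.sqrt (1 - r) : ℂ) • x)).trans
    (extIntegral_le_integral_toReal (fun θ => hf.lt_top _) hi)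
  rw [← EReal.coe_toReal hv.1 hv.2] at this
  exact EReal.coe_le_coe_iff.1 this

lemma IsCircularSymmetric.apply_smul (hsymm : IsCircularSymmetric f) {c : ℂ} (hc : ‖c‖ = 1)
    (w : EuclideanSpace ℂ (Fin n)) : f (c • w) = f w := by
  have h := hsymm (arg c) ⟨(neg_pi_lt_arg c).le, arg_le_pi c⟩ w
  have e : cexp (arg c * I) = c := by
    conv_rhs => rw [← Complex.norm_mul_exp_arg_mul_I c, hc]
    simp
  rwa [e] at h

end transfer

theorem theorem1p1 (n : ℕ) (f g : EuclideanSpace ℂ (Fin n) → EReal)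
    (hf : IsPlurisubharmonic f) (hg : IsPlurisubharmonic g)
    (hf2 : IsGaussianSquareIntegrable f) (hg2 : IsGaussianSquareIntegrable g)
    (hsymm : IsCircularSymmetric f) :
    (∫⁻ w, (f w).abs ∂(complexGaussian n) < ⊤) ∧
    (∫⁻ w, (g w).abs ∂(complexGaussian n) < ⊤) ∧
    (∫⁻ w, (f w * g w).abs ∂(complexGaussian n) < ⊤) ∧
    extIntegral (complexGaussian n) (fun w => f w * g w) ≥
      extIntegral (complexGaussian n) f * extIntegral (complexGaussian n) g := by
  have hfm := hf.measurable.ereal_toReal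
  have hgm := hg.measurable.ereal_toReal
  have hfL := hf2.memLp hf
  have hgL := hg2.memLp hg
  have hfa := hf2.ae_finite hf
  have hga := hg2.ae_finite hg
  have hfi := hfL.integrable (by norm_num)
  have hgi := hgL.integrable (by norm_num)
  have hfgi : Integrable (fun w => (f w * g w).toReal) (complexGaussian n) := by
    simp only [EReal.toReal_mul]
    exact hfL.integrable_mul hgL
  have hfga : ∀ᵐ w ∂(complexGaussian n), f w * g w ≠ ⊤ ∧ f w * g w ≠ ⊥ := by
    filter_upwards [hfa, hga] with w h1 h2
    rw [← EReal.coe_toReal h1.1 h1.2, ← EReal.coe_toReal h2.1 h2.2, ← EReal.coe_mul]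
    exact ⟨EReal.coe_ne_top _, EReal.coe_ne_bot _⟩
  refine ⟨lintegral_abs_lt_top hfa hfi, lintegral_abs_lt_top hga hgi,
    lintegral_abs_lt_top hfga hfgi, ?_⟩
  rw [extIntegral_eq_integral_toReal hfga hfgi, extIntegral_eq_integral_toReal hfa hfi,
    extIntegral_eq_integral_toReal hga hgi, ← EReal.coe_mul, ge_iff_le, EReal.coe_le_coe_iff,
    ← gaussianCorr_zero]
  simp only [EReal.toReal_mul]
  rw [← gaussianCorr_one hfm hgm]
  -- Symmetry of `f` enters only through radiality; subharmonicity uses `f` and `g` alike.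
  refine le_of_radial_four_avg (continuousOn_gaussianCorr hfL hgL) (fun s hs =>
    gaussianCorr_eq_norm hfm hgm (fun c hc w => by rw [hsymm.apply_smul hc]) hs) fun r hr0 hr1 => ?_
  exact exists_gaussianCorr_four_avg_ge hfL hgL hfm hgm hr0 hr1.le
    (ae_mixVec_memLp_and_nonneg hf hf2 hr0 hr1.le) (ae_mixVec_memLp_and_nonneg hg hg2 hr0 hr1.le)
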